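/- Let $X$ be a topological space, $\mathcal U=(U_i)_{i\in I}$ an open cover of $X$, $k$ a commutative ring, $C:=k_X$ the constant sheaf of rings on $X$, and $S$ a sheaf of $C$-modules. All tensor products are over $k$. For a sheaf $T$ of $C$-modules put: * (Čech cohomology) $\check H^n(\mathcal U,T)$ is the $n$-th cohomology of the complex of $k$-modules $$\check C^n(\mathcal U,T)=\prod_{(i_0,\dots,i_n)\in I^{n+1}}T(U_{i_0}\cap\dots\cap U_{i_n}),\qquad (d\alpha)_{i_0\dots i_{n+1}}=\sum_{j=0}^{n+1}(-1)^j\,\alpha_{i_0\dots\widehat{i_j}\dots i_{n+1}}\big|_{U_{i_0}\cap\dots\cap U_{i_{n+1}}} .$$ * (Sheaf cohomology) $H^n(X,T):=\operatorname{Ext}^n_C(C,T)=\operatorname{Hom}_{\mathcal D}(C,T[n])$, where $\mathcal D$ is the derived category of the abelian category of sheaves of $C$-modules. * (Canonical morphism) Let $\varepsilon_T:T\to\mathcal C^\bullet(\mathcal U,T)$ be the Čech resolution, $\mathcal C^n(\mathcal U,T)(V)=\prod_{(i_0,\dots,i_n)}T(V\cap U_{i_0}\cap\dots\cap U_{i_n})$,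 which is a quasi-isomorphism. For a complex $K$, the complex $K[n]$ is $K$ shifted by $n$, with $(-1)^n$ times the differential. A Čech cocycle $z\in\check C^n(\mathcal U,T)$ is a section over $X$ of $\mathcal C^n(\mathcal U,T)$ killed by the differential, hence is a morphism of complexes $C\to\mathcal C^\bullet(\mathcal U,T)[n]$; composing it in $\mathcal D$ with the inverse of $\varepsilon_T[n]$ gives an element of $H^n(X,T)$, which depends only on the class of $z$. This defines a $k$-linear map $\Phi_T:\check H^n(\mathcal U,T)\to H^n(X,T)$ for each $n\ge 0$. The Čech cup-product $c:\check H^q(\mathcal U,S)\otimes\check H^p(\mathcal U,C)\to\check H^{q+p}(\mathcal U,S)$ is induced by $$(\alpha\cup\beta)_{i_0\dots i_{q+p}}=\beta_{i_q\dots i_{q+p}}\cdot\alpha_{i_0\dots i_q}\quad\text{on }U_{i_0}\cap\dots\cap U_{i_{q+p}}$$ (multiplication of a section of $S$ by a section of $C$), and the "true" cup-product $t:H^q(X,S)\otimes H^p(X,C)\to H^{q+p}(X,S)$ is the composition $\operatorname{Ext}^q_C(C,S)\otimes\operatorname{Ext}^p_C(C,C)\to\operatorname{Ext}^{q+p}_C(C,S)$,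 $a\otimes b\mapsto a[p]\circ b$. **Multiplicative Čech Theorem.** For all $q,p\ge 0$, $$\Phi_S\circ c=t\circ(\Phi_S\otimes\Phi_C):\ \check H^q(\mathcal U,S)\otimes\check H^p(\mathcal U,C)\longrightarrow H^{q+p}(X,S).$$ -/

import Mathlib

open CategoryTheory Limits Opposite TopologicalSpace Simplicial

universe w v u

noncomputable section

namespace CechCup


section ExtClass

open CochainComplex HomComplex Abelian

variable {A : Type u} [Category.{v} A] [Abelian A]
  {M : A} {K : CochainComplex A ℕ} (ε : (CochainComplex.single₀ A).obj M ⟶ K)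

/-- A complex indexed by `ℕ`, extended by zero to negative degrees. -/
abbrev extendInt (K : CochainComplex A ℕ) : CochainComplex A ℤ :=
  K.extend ComplexShape.embeddingUpNat

/-- The terms of the extended complex in nonnegative degrees. -/
def extendIntXIso (K : CochainComplex A ℕ) (n : ℕ) : (extendInt K).X (n : ℤ) ≅ K.X n :=
  HomologicalComplex.extendXIso _ _ rfl

lemma extendInt_d (K : CochainComplex A ℕ) (i j : ℕ) :
    (extendInt K).d (i : ℤ) (j : ℤ) =
      (extendIntXIso K i).hom ≫ K.d i j ≫ (extendIntXIso K j).inv :=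
  HomologicalComplex.extend_d_eq _ _ rfl rfl

/-- The augmentation `M ⟶ K`, as a morphism of complexes indexed by `ℤ`. -/
def augmentationInt : (CochainComplex.singleFunctor A 0).obj M ⟶ extendInt K :=
  (HomologicalComplex.extendSingleIso _ _ _ _ (by simp)).inv ≫
    (ComplexShape.embeddingUpNat.extendFunctor A).map ε

instance [QuasiIso ε] : QuasiIso (augmentationInt ε) := by
  have h : QuasiIso (HomologicalComplex.extendMap ε ComplexShape.embeddingUpNat) := inferInstance
  have h' : IsIso (HomologicalComplex.extendSingleIso ComplexShape.embeddingUpNat M 0 0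
    (by simp)).inv := Iso.isIso_inv _
  have h'' : QuasiIso (HomologicalComplex.extendSingleIso ComplexShape.embeddingUpNat M 0 0
    (by simp)).inv := ⟨fun i => quasiIsoAt_of_isIso _ i⟩
  exact quasiIso_comp (HomologicalComplex.extendSingleIso ComplexShape.embeddingUpNat M 0 0
    rfl).inv (HomologicalComplex.extendMap ε ComplexShape.embeddingUpNat)

variable {T : A} {n : ℕ}

/-- A morphism `f : T ⟶ Kⁿ` with `f ≫ d = 0`, as a cocycle of degree `n` in the complex of
morphisms from `T[0]` to `K`. -/
def homCocycle (f : T ⟶ K.X n) (hf : f ≫ K.d n (n + 1) = 0) :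
    Cocycle ((CochainComplex.singleFunctor A 0).obj T) (extendInt K) (n : ℤ) :=
  Cocycle.fromSingleMk (f ≫ (extendIntXIso K n).inv) (zero_add _) ((n + 1 : ℕ) : ℤ) (by simp)
    (by rw [extendInt_d]; simp [reassoc_of% hf])

variable [HasExt.{w} A] [QuasiIso ε]

/-- Let `ε : M ⟶ K` be a resolution and let `f : T ⟶ Kⁿ` be such that `f ≫ d = 0`. This is the
class in `Extⁿ(T, M)` of `f`: the morphism of complexes `T ⟶ K[n]` given by `f`, followed in
the derived category by the inverse of `ε[n] : M[n] ⟶ K[n]`. -/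
def extClass (f : T ⟶ K.X n) (hf : f ≫ K.d n (n + 1) = 0) : Ext.{w} T M n :=
  letI := HasDerivedCategory.standard A
  Ext.homEquiv.symm
    ((DerivedCategory.singleFunctorIsoCompQ A 0).hom.app T ≫
      DerivedCategory.Q.map (Cocycle.equivHomShift.symm (homCocycle f hf)) ≫
      (DerivedCategory.Q.commShiftIso (n : ℤ)).hom.app (extendInt K) ≫
      (inv (DerivedCategory.Q.map (augmentationInt ε)) ≫
        (DerivedCategory.singleFunctorIsoCompQ A 0).inv.app M)⟦(n : ℤ)⟧')

lemma extClass_hom (f : T ⟶ K.X n) (hf : f ≫ K.d n (n + 1) = 0) :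
    letI := HasDerivedCategory.standard A
    (extClass.{w} ε f hf).hom = (DerivedCategory.singleFunctorIsoCompQ A 0).hom.app T ≫
      DerivedCategory.Q.map (Cocycle.equivHomShift.symm (homCocycle f hf)) ≫
      (DerivedCategory.Q.commShiftIso (n : ℤ)).hom.app (extendInt K) ≫
      (inv (DerivedCategory.Q.map (augmentationInt ε)) ≫
        (DerivedCategory.singleFunctorIsoCompQ A 0).inv.app M)⟦(n : ℤ)⟧' := by
  let := HasDerivedCategory.standard A
  exact Equiv.apply_symm_apply _ _

lemma extClass_add (f g : T ⟶ K.X n) (hf : f ≫ K.d n (n + 1) = 0) (hg : g ≫ K.d n (n + 1) = 0) :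
    extClass.{w} ε (f + g) (by rw [Preadditive.add_comp, hf, hg, add_zero]) =
      extClass.{w} ε f hf + extClass.{w} ε g hg := by
  let := HasDerivedCategory.standard A
  ext
  rw [Ext.add_hom, extClass_hom, extClass_hom, extClass_hom]
  have : homCocycle (f + g) (by rw [Preadditive.add_comp, hf, hg, add_zero]) =
      homCocycle f hf + homCocycle g hg := by
    unfold homCocycle
    rw [← Cocycle.fromSingleMk_add]
    simp only [Preadditive.add_comp]
  rw [this]
  simp only [map_add, Functor.map_add, Preadditive.add_comp, Preadditive.comp_add]

lemma mk₀_comp_extClass {T' : A} (g : T' ⟶ T) (f : T ⟶ K.X n) (hf : f ≫ K.d n (n + 1) = 0) :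
    (Ext.mk₀ g).comp (extClass.{w} ε f hf) (zero_add _) =
      extClass.{w} ε (g ≫ f) (by rw [Category.assoc, hf, comp_zero]) := by
  let := HasDerivedCategory.standard A
  ext
  rw [Ext.comp_hom, extClass_hom, extClass_hom, Ext.mk₀_hom, ShiftedHom.mk₀_comp]
  have : homCocycle (g ≫ f) (by rw [Category.assoc, hf, comp_zero]) =
      (homCocycle f hf).precomp ((singleFunctor A 0).map g) := by
    unfold homCocycle
    rw [← Cocycle.fromSingleMk_precomp]
    congr 1
    exact Category.assoc _ _ _
  rw [this, Cocycle.equivHomShift_symm_precomp, 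
    DerivedCategory.Q.map_comp]
  refine ((DerivedCategory.singleFunctorIsoCompQ A 0).hom.naturality_assoc g _).trans ?_
  exact congrArg _ (Category.assoc _ _ _).symm

lemma extClass_smul {k : Type*} [CommRing k] [Linear k A] (r : k)
    (f : T ⟶ K.X n) (hf : f ≫ K.d n (n + 1) = 0) :
    extClass.{w} ε (r • f) (by rw [Linear.smul_comp, hf, smul_zero]) =
      r • extClass.{w} ε f hf := by
  have h : r • extClass.{w} ε f hf =
      (Ext.mk₀ (r • 𝟙 T)).comp (extClass.{w} ε f hf) (zero_add _) := by
    rw [Ext.mk₀_smul, Ext.smul_comp, Ext.mk₀_id_comp]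
  rw [h, mk₀_comp_extClass]
  congr 1
  simp

lemma extClass_d {m : ℕ} (hm : m + 1 = n) (g : T ⟶ K.X m) :
    extClass.{w} ε (g ≫ K.d m n) (by simp) = 0 := by
  let := HasDerivedCategory.standard A
  ext
  rw [Ext.zero_hom, extClass_hom]
  have h1 : homCocycle (g ≫ K.d m n) (by simp) ∈ coboundaries _ _ _ := by
    unfold homCocycle
    rw [Cocycle.fromSingleMk_mem_coboundaries_iff _ _ _ _ _ (m : ℤ) (by omega)]
    refine ⟨g ≫ (extendIntXIso K m).inv, ?_⟩
    rw [extendInt_d]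
    simp
  rw [← CohomologyClass.toHom_mk_eq_zero_iff, CohomologyClass.toHom_mk,
    HomotopyCategory.quotient_map_eq_zero_iff] at h1
  have h2 : DerivedCategory.Q.map
      (Cocycle.equivHomShift.symm (homCocycle (g ≫ K.d m n) (by simp))) = 0 := by
    rw [← (DerivedCategory.Q (C := A)).map_zero]
    exact DerivedCategory.Q_map_eq_of_homotopy _ h1.some
  rw [h2]
  simp

end ExtClass


section Modules
variable (X : TopCat.{u}) (k : Type u) [CommRing k]

/-- The constant sheaf `k_X`, as a sheaf of commutative rings on `X`. -/
def constSheaf : Sheaf (Opens.grothendieckTopology X) CommRingCat.{u} :=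
  (constantSheaf (Opens.grothendieckTopology X) CommRingCat.{u}).obj (CommRingCat.of k)

/-- `k_X`, as a sheaf of rings. -/
def constRing : Sheaf (Opens.grothendieckTopology X) RingCat.{u} :=
  (sheafCompose _ (forget₂ CommRingCat.{u} RingCat.{u})).obj (constSheaf X k)

/-- The category of sheaves of `k_X`-modules. -/
abbrev Mod := SheafOfModules.{u} (constRing X k)

/-- `k_X`, as a sheaf of modules over itself. -/
abbrev constMod : Mod X k := SheafOfModules.unit (constRing X k)

/-- The sections of `k_X` over `V`. -/
abbrev Sec (V : (Opens X)ᵒᵖ) : Type u := (constRing X k).obj.obj V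

lemma sec_mul_comm {V : (Opens X)ᵒᵖ} (a b : Sec X k V) : a * b = b * a :=
  mul_comm (G := (constSheaf X k).obj.obj V) a b

/-- The canonical ring morphism from `k` to the sections of `k_X` over `V`. -/
def constSec (V : (Opens X)ᵒᵖ) : k →+* Sec X k V :=
  ((toSheafify (Opens.grothendieckTopology X)
    ((Functor.const (Opens X)ᵒᵖ).obj (CommRingCat.of k))).app V).hom

lemma constSec_map {V W : (Opens X)ᵒᵖ} (f : V ⟶ W) (a : k) :
    (constRing X k).obj.map f (constSec X k V a) = constSec X k W a := by
  have := ((toSheafify (Opens.grothendieckTopology X)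
    ((Functor.const (Opens X)ᵒᵖ).obj (CommRingCat.of k))).naturality f)
  exact (congr($(this).hom a)).symm

variable {X k}


/-- Multiplication by `a : k` on a sheaf of `k_X`-modules. -/
def scalarEnd (a : k) (M : Mod X k) : M ⟶ M where
  val := PresheafOfModules.homMk
    { app V := AddCommGrpCat.ofHom
        (DistribSMul.toAddMonoidHom (M.val.obj V) (constSec X k V a))
      naturality V W f := by
        ext m
        have h := M.val.map_smul f (constSec X k V a) m
        rw [constSec_map] at h
        exact h.symm }
    (fun V r m => by
      change constSec X k V a • r • (m : M.val.obj V) = r • constSec X k V a • m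
      rw [smul_smul, smul_smul, sec_mul_comm])

lemma scalarEnd_apply (a : k) (M : Mod X k) (V : (Opens X)ᵒᵖ) (m : M.val.obj V) :
    (scalarEnd a M).val.app V m = constSec X k V a • m := rfl

lemma mod_hom_ext {M N : Mod X k} {f g : M ⟶ N}
    (h : ∀ (V : (Opens X)ᵒᵖ) (m : M.val.obj V), f.val.app V m = g.val.app V m) : f = g := by
  ext V m
  exact h V m

variable (X k) in
/-- `k` acts on the category of sheaves of `k_X`-modules. -/
def toCatCenter : k →+* CatCenter (Mod X k) where
  toFun a :=
    { app M := scalarEnd a M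
      naturality M N f := by
        apply mod_hom_ext
        intro V m
        exact ((f.val.app V).hom.map_smul (constSec X k V a) m).symm }
  map_one' := by
    refine CatCenter.ext _ _ fun M => ?_
    apply mod_hom_ext
    intro V m
    change constSec X k V 1 • m = m
    rw [map_one, one_smul]
  map_mul' a b := by
    refine CatCenter.ext _ _ fun M => ?_
    apply mod_hom_ext
    intro V m
    change constSec X k V (a * b) • m = constSec X k V a • constSec X k V b • m
    rw [map_mul, mul_smul]
  map_zero' := by
    refine CatCenter.ext _ _ fun M => ?_
    apply mod_hom_ext
    intro V m
    change constSec X k V 0 • m = 0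
    rw [map_zero, zero_smul]
  map_add' a b := by
    refine CatCenter.ext _ _ fun M => ?_
    apply mod_hom_ext
    intro V m
    change constSec X k V (a + b) • m = constSec X k V a • m + constSec X k V b • m
    rw [map_add, add_smul]

instance : Linear k (Mod X k) := Linear.ofRingMorphism (toCatCenter X k)

lemma smul_app_apply (a : k) {M N : Mod X k} (f : M ⟶ N) (V : (Opens X)ᵒᵖ) (m : M.val.obj V) :
    (a • f).val.app V m = constSec X k V a • f.val.app V m :=
  (f.val.app V).hom.map_smul (constSec X k V a) m

/-- The underlying presheaf of `k`-modules. -/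
def kPresheaf (M : Mod X k) : (Opens X)ᵒᵖ ⥤ ModuleCat.{u} k where
  obj V := (ModuleCat.restrictScalars (constSec X k V)).obj (M.val.obj V)
  map {V W} f := ModuleCat.ofHom
    (X := (ModuleCat.restrictScalars (constSec X k V)).obj (M.val.obj V))
    (Y := (ModuleCat.restrictScalars (constSec X k W)).obj (M.val.obj W))
    { toFun := fun m => M.val.map f m
      map_add' := fun x y => map_add (M.val.map f).hom x y
      map_smul' := fun a m => by
        have h := M.val.map_smul f (constSec X k V a) m
        rw [constSec_map] at h
        exact h }
  map_id V := by
    ext m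
    exact congr($(M.val.presheaf.map_id V) m)
  map_comp f g := by
    ext m
    exact congr($(M.val.presheaf.map_comp f g) m)

lemma kPresheaf_smul (M : Mod X k) (V : (Opens X)ᵒᵖ) (a : k) (m : (kPresheaf M).obj V) :
    a • m = (constSec X k V a • (show M.val.obj V from m) : M.val.obj V) := rfl

section Inter
variable (W : Opens X)

/-- `V ↦ V ∩ W`. -/
def interFunctor : Opens X ⥤ Opens X where
  obj V := V ⊓ W
  map f := homOfLE (inf_le_inf_right W f.le)


lemma star_left (V : Opens X) : ((Over.star W).obj V).left = V ⊓ W := by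
  change (W ⨯ V) = V ⊓ W
  apply le_antisymm
  · exact le_inf (leOfHom prod.snd) (leOfHom prod.fst)
  · exact leOfHom (prod.lift (homOfLE inf_le_right) (homOfLE inf_le_left))

instance : (interFunctor W).IsContinuous
    (Opens.grothendieckTopology X) (Opens.grothendieckTopology X) :=
  Functor.isContinuous_comp' (F₁ := Over.star W) (F₂ := Over.forget W) (F₁₂ := interFunctor W)
    (NatIso.ofComponents (fun V => eqToIso (star_left W V)) (by intros; apply Subsingleton.elim))
    _ ((Opens.grothendieckTopology X).over W) _

/-- Restriction of sections of `k_X`. -/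
def secRes {V W : Opens X} (h : W ≤ V) : Sec X k (op V) →+* Sec X k (op W) :=
  ((constRing X k).obj.map (homOfLE h).op).hom

lemma secRes_secRes {U V W : Opens X} (h : V ≤ U) (h' : W ≤ V) (r : Sec X k (op U)) :
    secRes h' (secRes h r) = secRes (h'.trans h) r :=
  congr($((constRing X k).obj.map_comp (homOfLE h).op (homOfLE h').op) r).symm

variable (X k) in
/-- The restriction morphisms `k_X(V) → k_X(V ∩ W)`. -/
def constRingInter : constRing X k ⟶
    ((interFunctor W).sheafPushforwardContinuous RingCat.{u} (Opens.grothendieckTopology X)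
      (Opens.grothendieckTopology X)).obj (constRing X k) where
  hom :=
    { app V := (constRing X k).obj.map (homOfLE (inf_le_left : V.unop ⊓ W ≤ V.unop)).op
      naturality V V' f := by
        change (constRing X k).obj.map _ ≫ (constRing X k).obj.map _ =
          (constRing X k).obj.map _ ≫ (constRing X k).obj.map _
        ext r
        exact (secRes_secRes (leOfHom f.unop) (inf_le_left : V'.unop ⊓ W ≤ V'.unop) r).trans
          (secRes_secRes (inf_le_left : V.unop ⊓ W ≤ V.unop)
            (inf_le_inf_right W (leOfHom f.unop)) r).symm }

/-- The sheaf `V ↦ M(V ∩ W)`. -/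
def interSheaf (M : Mod X k) : Mod X k :=
  (SheafOfModules.pushforward (constRingInter X k W)).obj M

/-- Restriction of sections. -/
abbrev res (M : Mod X k) {V W : Opens X} (h : W ≤ V) : M.val.obj (op V) → M.val.obj (op W) :=
  fun m => M.val.map (homOfLE h).op m

lemma res_res (M : Mod X k) {U V W : Opens X} (h : V ≤ U) (h' : W ≤ V) (m : M.val.obj (op U)) :
    res M h' (res M h m) = res M (h'.trans h) m :=
  (M.val.map_comp_apply (homOfLE h).op (homOfLE h').op m).symm

lemma res_add (M : Mod X k) {V W : Opens X} (h : W ≤ V) (m m' : M.val.obj (op V)) :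
    res M h (m + m') = res M h m + res M h m' := map_add (M.val.map (homOfLE h).op).hom m m'

lemma res_smul (M : Mod X k) {V W : Opens X} (h : W ≤ V) (r : Sec X k (op V))
    (m : M.val.obj (op V)) :
    res M h (r • m) = secRes h r • res M h m :=
  M.val.map_smul (homOfLE h).op r m

/-- Morphisms into `interSheaf W M`. -/
def toInter (N M : Mod X k) (W : Opens X) (f : ∀ V : Opens X, N.val.obj (op V) → M.val.obj (op (V ⊓ W)))
    (hadd : ∀ V m m', f V (m + m') = f V m + f V m')
    (hsmul : ∀ V (r : Sec X k (op V)) m, f V (r • m) =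
      secRes (inf_le_left : V ⊓ W ≤ V) r • f V m)
    (hres : ∀ V V' (h : V' ≤ V) m, f V' (res N h m) = res M (inf_le_inf_right W h) (f V m)) :
    N ⟶ interSheaf W M where
  val := PresheafOfModules.homMk
    { app V := AddCommGrpCat.ofHom (AddMonoidHom.mk' (f V.unop) (hadd V.unop))
      naturality V V' g := by
        ext m
        exact hres V.unop V'.unop (leOfHom g.unop) m }
    (fun V r m => hsmul V.unop r m)

/-- The functor `W ↦ (V ↦ M(V ∩ W))`. -/
def interFunctorSheaf (M : Mod X k) : (Opens X)ᵒᵖ ⥤ Mod X k where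
  obj W := interSheaf W.unop M
  map {W W'} g := toInter _ _ _
    (fun V m => res M (inf_le_inf_left V (leOfHom g.unop)) (show M.val.obj (op (V ⊓ W.unop)) from m))
    (fun _ _ _ => res_add _ _ _ _) (fun V r m => by
      exact (res_smul M _ (secRes inf_le_left r) _).trans (by rw [secRes_secRes]))
    (fun V V' h m => (res_res M _ _ _).trans (res_res M _ _ _).symm)
  map_id W := by
    apply mod_hom_ext
    intro V m
    exact congr($(M.val.presheaf.map_id _) m)
  map_comp g g' := by
    apply mod_hom_ext
    intro V m
    exact (res_res M _ _ _).symm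

lemma interFunctorSheaf_map_apply (M : Mod X k) {W W' : (Opens X)ᵒᵖ} (g : W ⟶ W') (V : Opens X)
   (m : M.val.obj (op (V ⊓ W.unop))) : ((interFunctorSheaf M).map g).val.app (op V) m =
    res M (inf_le_inf_left V (leOfHom g.unop)) m := rfl

/-- Restriction `M(V) → M(V ∩ W)`. -/
def resInter (M : Mod X k) (W : Opens X) : M ⟶ interSheaf W M :=
  toInter _ _ _ (fun _ m => res M inf_le_left m) (fun _ _ _ => res_add _ _ _ _)
    (fun _ _ _ => res_smul M _ _ _) (fun _ _ _ _ => (res_res M _ _ _).trans (res_res M _ _ _).symm)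

/-- The map `k_X(V) → M(V ∩ W)`, `r ↦ r|_{V ∩ W} • s|_{V ∩ W}`. -/
def smulRes (M : Mod X k) {W : Opens X} (s : M.val.obj (op W)) (V : Opens X) (r : Sec X k (op V)) :
    M.val.obj (op (V ⊓ W)) :=
  secRes (inf_le_left : V ⊓ W ≤ V) r • res M inf_le_right s

lemma smulRes_add (M : Mod X k) {W : Opens X} (s : M.val.obj (op W)) (V : Opens X)
    (r r' : Sec X k (op V)) : smulRes M s V (r + r') = smulRes M s V r + smulRes M s V r' := by
  unfold smulRes
  rw [map_add, add_smul]

lemma smulRes_mul (M : Mod X k) {W : Opens X} (s : M.val.obj (op W)) (V : Opens X)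
    (r r' : Sec X k (op V)) : smulRes M s V (r * r') =
      secRes (inf_le_left : V ⊓ W ≤ V) r • smulRes M s V r' := by
  unfold smulRes
  rw [map_mul, mul_smul]

lemma res_smulRes (M : Mod X k) {W : Opens X} (s : M.val.obj (op W)) {V V' : Opens X} (h : V' ≤ V)
    (r : Sec X k (op V)) : smulRes M s V' (secRes h r) =
      res M (inf_le_inf_right W h) (smulRes M s V r) := by
  unfold smulRes
  rw [res_smul, res_res, secRes_secRes, secRes_secRes]

lemma smulRes_add_right (M : Mod X k) {W : Opens X} (s s' : M.val.obj (op W)) (V : Opens X)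
    (r : Sec X k (op V)) : smulRes M (s + s') V r = smulRes M s V r + smulRes M s' V r := by
  unfold smulRes
  rw [res_add, smul_add]

lemma secRes_constSec {V W : Opens X} (h : W ≤ V) (a : k) :
    secRes h (constSec X k (op V) a) = constSec X k (op W) a :=
  constSec_map X k (homOfLE h).op a

lemma smulRes_smul_right (M : Mod X k) {W : Opens X} (a : k) (s : M.val.obj (op W)) (V : Opens X)
    (r : Sec X k (op V)) : smulRes M (constSec X k (op W) a • s) V r =
      constSec X k (op (V ⊓ W)) a • smulRes M s V r := by
  unfold smulRes
  rw [res_smul, secRes_constSec, smul_smul, smul_smul, sec_mul_comm]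

lemma res_smulRes_left (M : Mod X k) {W W' : Opens X} (h : W' ≤ W) (s : M.val.obj (op W))
    (V : Opens X) (r : Sec X k (op V)) :
    res M (inf_le_inf_left V h) (smulRes M s V r) = smulRes M (res M h s) V r := by
  unfold smulRes
  rw [res_smul, secRes_secRes, res_res, res_res]

/-- A section of `M` over `W`, as a morphism from `k_X` to `V ↦ M(V ∩ W)`. -/
def sectionHom (M : Mod X k) (W : Opens X) :
    (kPresheaf M).obj (op W) →ₗ[k] (constMod X k ⟶ interSheaf W M) where
  toFun s := toInter (constMod X k) M W (fun V => smulRes M s V)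
    (fun V => smulRes_add M s V) (fun V => smulRes_mul M s V) (fun _ _ h => res_smulRes M s h)
  map_add' s s' := mod_hom_ext fun V r => smulRes_add_right M s s' V.unop r
  map_smul' a s := by
    apply mod_hom_ext
    intro V r
    rw [RingHom.id_apply, smul_app_apply]
    exact (smulRes_smul_right M a s V.unop r).trans
      (by rw [← secRes_constSec (V := V.unop) inf_le_left]; rfl)

lemma sectionHom_apply (M : Mod X k) (W : Opens X) (s : (kPresheaf M).obj (op W)) (V : Opens X)
    (r : Sec X k (op V)) : (sectionHom M W s).val.app (op V) r = smulRes M s V r := rfl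

lemma sectionHom_naturality (M : Mod X k) {W W' : (Opens X)ᵒᵖ} (g : W ⟶ W')
    (s : (kPresheaf M).obj W) :
    sectionHom M W.unop s ≫ (interFunctorSheaf M).map g =
      sectionHom M W'.unop ((kPresheaf M).map g s) := by
  apply mod_hom_ext
  intro V r
  exact res_smulRes_left M (leOfHom g.unop) s V.unop r

end Inter

section Cech

variable {A : Type*} [Category A] [HasProducts.{u} A] [Preadditive A] {ι : Type u}
  (U : ι → Opens X) (P : (Opens X)ᵒᵖ ⥤ A)

/-- The intersection `U_{i₀} ∩ ⋯ ∩ U_{iₙ}`. -/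
abbrev inter {n : ℕ} (x : Fin (n + 1) → ι) : Opens X := ∏ᶜ (U ∘ x)

lemma inter_eq {n : ℕ} (x : Fin (n + 1) → ι) : inter U x = ⨅ j, U (x j) :=
  le_antisymm (le_iInf fun j => leOfHom (Pi.π (U ∘ x) j))
    (leOfHom (Pi.lift fun j => homOfLE (iInf_le _ j)))

/-- The Čech complex of a presheaf `P` for the family `U`: its term of degree `n` is the product,
over all `(i₀, …, iₙ)`, of the `P (U_{i₀} ∩ ⋯ ∩ U_{iₙ})`. -/
abbrev cech : CochainComplex A ℕ := (cechComplexFunctor U).obj P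

/-- The projection of the Čech complex to the factor `x = (i₀, …, iₙ)`. -/
def cechπ {n : ℕ} (x : Fin (n + 1) → ι) : (cech U P).X n ⟶ P.obj (op (inter U x)) :=
  Pi.π (fun x : Fin (n + 1) → ι => P.obj (op (inter U x))) x

/-- The morphism to the Čech complex with given components. -/
def cechLift {n : ℕ} {T : A} (f : ∀ x : Fin (n + 1) → ι, T ⟶ P.obj (op (inter U x))) :
    T ⟶ (cech U P).X n :=
  Pi.lift f

lemma cechLift_π {n : ℕ} {T : A} (f : ∀ x : Fin (n + 1) → ι, T ⟶ P.obj (op (inter U x))) (x) :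
  cechLift U P f ≫ cechπ U P x = f x := Pi.lift_π _ _

lemma cechLift_π_assoc {n : ℕ} {T : A}
    (f : ∀ x : Fin (n + 1) → ι, T ⟶ P.obj (op (inter U x))) (x)
    {L : A} (g : P.obj (op (inter U x)) ⟶ L) :
    cechLift U P f ≫ cechπ U P x ≫ g = f x ≫ g := by
  rw [← Category.assoc, cechLift_π]

lemma cech_hom_ext {n : ℕ} {T : A} {f g : T ⟶ (cech U P).X n}
    (h : ∀ x, f ≫ cechπ U P x = g ≫ cechπ U P x) : f = g :=
  Pi.hom_ext _ _ h

lemma inter_le_succAbove {n : ℕ} (x : Fin (n + 2) → ι) (j : Fin (n + 2)) :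
    inter U x ≤ inter U (x ∘ j.succAbove) := by
  rw [inter_eq, inter_eq]
  exact le_iInf fun i => iInf_le _ _

lemma cech_d_π {n : ℕ} (x : Fin (n + 2) → ι) :
    (cech U P).d n (n + 1) ≫ cechπ U P x =
      ∑ j : Fin (n + 2), (-1 : ℤ) ^ (j : ℕ) • (cechπ U P (x ∘ j.succAbove) ≫
        P.map (homOfLE (inter_le_succAbove U x j)).op) := by
  have h1 : (cech U P).d n (n + 1) = AlgebraicTopology.AlternatingCofaceMapComplex.objD
      ((FormalCoproduct.cosimplicialObjectFunctor (FormalCoproduct.mk _ U).cech).obj P) n :=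
    CochainComplex.of_d (fun n => ((FormalCoproduct.cosimplicialObjectFunctor
      (FormalCoproduct.mk _ U).cech).obj P).obj ⦋n⦌)
      (AlgebraicTopology.AlternatingCofaceMapComplex.objD _) n
  have h2 : ∀ T : A, ∀ π : ((FormalCoproduct.cosimplicialObjectFunctor
      (FormalCoproduct.mk _ U).cech).obj P).obj ⦋n + 1⦌ ⟶ T,
      AlgebraicTopology.AlternatingCofaceMapComplex.objD
      ((FormalCoproduct.cosimplicialObjectFunctor (FormalCoproduct.mk _ U).cech).obj P) n ≫ π =
      ∑ j : Fin (n + 2), (-1 : ℤ) ^ (j : ℕ) • (CosimplicialObject.δ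
        ((FormalCoproduct.cosimplicialObjectFunctor (FormalCoproduct.mk _ U).cech).obj P) j ≫ π) :=
    fun T π => by
      simp only [AlgebraicTopology.AlternatingCofaceMapComplex.objD, Preadditive.sum_comp,
        Preadditive.zsmul_comp]
  rw [h1]
  refine (h2 _ (cechπ U P x)).trans (Finset.sum_congr rfl fun j _ => ?_)
  congr 1
  exact Pi.lift_π _ _

end Cech

end Modules


section Exactness
variable {X : TopCat.{u}} {k : Type u} [CommRing k]

lemma epi_of_locally {M N : Mod X k} (f : M ⟶ N)
    (h : ∀ (V : Opens X) (s : N.val.obj (op V)), ∀ p ∈ V, ∃ (V' : Opens X) (hV : V' ≤ V),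
      p ∈ V' ∧ ∃ t : M.val.obj (op V'), f.val.app (op V') t = res N hV s) : Epi f := by
  have : Sheaf.IsLocallySurjective ((SheafOfModules.toSheaf (constRing X k)).map f) := by
    constructor
    intro V s p hp
    obtain ⟨V', hV, hp', t, ht⟩ := h V s p hp
    exact ⟨V', homOfLE hV, ⟨t, ht⟩, hp'⟩
  have : Epi ((SheafOfModules.toSheaf (constRing X k)).map f) := inferInstance
  exact (SheafOfModules.toSheaf (constRing X k)).epi_of_epi_map this

lemma app_injective {M N : Mod X k} (f : M ⟶ N) [Mono f] (V : (Opens X)ᵒᵖ) :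
    Function.Injective (f.val.app V) := by
  have : Mono ((SheafOfModules.evaluation (constRing X k) V).map f) := inferInstance
  exact (ModuleCat.mono_iff_injective _).1 this

lemma app_res {M N : Mod X k} (f : M ⟶ N) {V W : Opens X} (h : W ≤ V) (m : M.val.obj (op V)) :
    f.val.app (op W) (res M h m) = res N h (f.val.app (op V) m) :=
  PresheafOfModules.naturality_apply f.val (homOfLE h).op m

lemma comp_app {M N L : Mod X k} (f : M ⟶ N) (g : N ⟶ L) (V : (Opens X)ᵒᵖ) (m : M.val.obj V) :
    (f ≫ g).val.app V m = g.val.app V (f.val.app V m) := rfl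

lemma exact_of_locally (S : ShortComplex (Mod X k))
    (h : ∀ (V : Opens X) (s : S.X₂.val.obj (op V)), S.g.val.app (op V) s = 0 → ∀ p ∈ V,
      ∃ (V' : Opens X) (hV : V' ≤ V), p ∈ V' ∧ ∃ t : S.X₁.val.obj (op V'),
        S.f.val.app (op V') t = res S.X₂ hV s) : S.Exact := by
  rw [ShortComplex.exact_iff_epi_kernel_lift]
  apply epi_of_locally
  intro V s p hp
  obtain ⟨V', hV, hp', t, ht⟩ := h V ((kernel.ι S.g).val.app (op V) s)
    (by rw [← comp_app, kernel.condition]; rfl) p hp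
  refine ⟨V', hV, hp', t, ?_⟩
  apply app_injective (kernel.ι S.g)
  rw [← comp_app, kernel.lift_ι, app_res, ht]

section
variable {α : Type u} (F : α → Mod X k) (V : (Opens X)ᵒᵖ)

/-- Sections of a product. -/
def evalFan : IsLimit (Fan.mk ((SheafOfModules.evaluation (constRing X k) V).obj (∏ᶜ F))
    (fun a => (SheafOfModules.evaluation (constRing X k) V).map (Pi.π F a))) :=
  isLimitFanMkObjOfIsLimit _ _ _ (productIsProduct F)

lemma prod_ext {m m' : (∏ᶜ F).val.obj V}
    (h : ∀ a, (Pi.π F a).val.app V m = (Pi.π F a).val.app V m') : m = m' := by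
  have : ModuleCat.ofHom (LinearMap.toSpanSingleton (Sec X k V) _ m) =
      ModuleCat.ofHom (LinearMap.toSpanSingleton (Sec X k V) _ m') := by
    refine (evalFan F V).hom_ext ?_
    rintro ⟨a⟩
    ext
    change (Pi.π F a).val.app V ((1 : Sec X k V) • m) =
      (Pi.π F a).val.app V ((1 : Sec X k V) • m')
    rw [one_smul, one_smul, h a]
  simpa using congr($(this).hom (1 : Sec X k V))

lemma prod_exists (f : ∀ a, (F a).val.obj V) :
    ∃ m : (∏ᶜ F).val.obj V, ∀ a, (Pi.π F a).val.app V m = f a := by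
  let c : Fan (fun a => (SheafOfModules.evaluation (constRing X k) V).obj (F a)) :=
    Fan.mk (ModuleCat.of (Sec X k V) (Sec X k V)) (fun a =>
      ModuleCat.ofHom (LinearMap.toSpanSingleton (Sec X k V) ((F a).val.obj V) (f a)))
  refine ⟨((evalFan F V).lift c).hom (1 : Sec X k V), fun a => ?_⟩
  have := (evalFan F V).fac c ⟨a⟩
  refine congr($(this).hom (1 : Sec X k V)).trans ?_
  exact one_smul (Sec X k V) (f a)
end

section Resolution
variable {ι : Type u} (U : ι → Opens X) (M : Mod X k)

/-- The Čech resolution of the sheaf `M`: its term of degree `n` is the sheaf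
`V ↦ ∏ M(V ∩ U_{i₀} ∩ ⋯ ∩ U_{iₙ})`. -/
abbrev cechSheaf : CochainComplex (Mod X k) ℕ := cech U (interFunctorSheaf M)

/-- The augmentation in degree `0`, given by restriction of sections. -/
def cechε₀ : M ⟶ (cechSheaf U M).X 0 :=
  cechLift U (interFunctorSheaf M) (fun x => resInter M (inter U x))

lemma resInter_comp {W W' : (Opens X)ᵒᵖ} (g : W ⟶ W') :
    resInter M W.unop ≫ (interFunctorSheaf M).map g = resInter M W'.unop := by
  apply mod_hom_ext
  intro V m
  exact res_res M _ _ _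

lemma cechε₀_π_map (x : Fin 1 → ι) {W : Opens X} (h : W ≤ inter U x) :
    cechε₀ U M ≫ cechπ U (interFunctorSheaf M) x ≫ (interFunctorSheaf M).map (homOfLE h).op =
      resInter M W := by
  exact (cechLift_π_assoc U (interFunctorSheaf M)
    (fun x => (resInter M (inter U x) : M ⟶ (interFunctorSheaf M).obj (op (inter U x)))) x
    ((interFunctorSheaf M).map (homOfLE h).op)).trans (resInter_comp M (homOfLE h).op)

lemma cechε₀_d : cechε₀ U M ≫ (cechSheaf U M).d 0 1 = 0 := by
  apply cech_hom_ext
  intro x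
  rw [Category.assoc, cech_d_π, Fin.sum_univ_two]
  simp only [Preadditive.comp_add, Preadditive.comp_zsmul, zero_comp, cechε₀_π_map]
  simp only [Fin.val_zero, Fin.val_one, pow_zero, pow_one]
  exact (congrArg₂ _ (one_zsmul _) (neg_one_zsmul _)).trans (add_neg_cancel _)

/-- The augmentation of the Čech resolution. -/
def cechε : (CochainComplex.single₀ (Mod X k)).obj M ⟶ cechSheaf U M :=
  (CochainComplex.fromSingle₀Equiv _ _).symm ⟨cechε₀ U M, cechε₀_d U M⟩

/-- Evaluation of morphisms at a section. -/
def evalHom {N L : Mod X k} {V : (Opens X)ᵒᵖ} (s : N.val.obj V) : (N ⟶ L) →+ L.val.obj V where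
  toFun f := f.val.app V s
  map_zero' := rfl
  map_add' _ _ := rfl

/-- Components of sections. -/
def comp {n : ℕ} {V : Opens X} (x : Fin (n + 1) → ι)
    (s : ((cechSheaf U M).X n).val.obj (op V)) : M.val.obj (op (V ⊓ inter U x)) :=
  (cechπ U (interFunctorSheaf M) x).val.app (op V) s

lemma comp_d {n : ℕ} {V : Opens X} (x : Fin (n + 2) → ι)
    (s : ((cechSheaf U M).X n).val.obj (op V)) :
    comp U M x (((cechSheaf U M).d n (n + 1)).val.app (op V) s) =
      ∑ j : Fin (n + 2), (-1 : ℤ) ^ (j : ℕ) •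
        res M (inf_le_inf_left V (inter_le_succAbove U x j)) (comp U M (x ∘ j.succAbove) s) := by
  have h := congrArg (evalHom s) (cech_d_π U (interFunctorSheaf M) x)
  rw [map_sum] at h
  simp only [map_zsmul] at h
  exact h

lemma comp_res {n : ℕ} {V V' : Opens X} (h : V' ≤ V) (x : Fin (n + 1) → ι)
    (s : ((cechSheaf U M).X n).val.obj (op V)) :
    comp U M x (res _ h s) = res M (inf_le_inf_right _ h) (comp U M x s) := 
  app_res (cechπ U (interFunctorSheaf M) x) h s


lemma comp_ext {n : ℕ} {V : Opens X} {s s' : ((cechSheaf U M).X n).val.obj (op V)}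
    (h : ∀ x, comp U M x s = comp U M x s') : s = s' :=
  prod_ext (fun x : Fin (n + 1) → ι => (interFunctorSheaf M).obj (op (inter U x))) (op V) h

lemma comp_exists {n : ℕ} {V : Opens X}
    (f : ∀ x : Fin (n + 1) → ι, M.val.obj (op (V ⊓ inter U x))) :
    ∃ s : ((cechSheaf U M).X n).val.obj (op V), ∀ x, comp U M x s = f x :=
  prod_exists (fun x : Fin (n + 1) → ι => (interFunctorSheaf M).obj (op (inter U x))) (op V) f

lemma comp_congr {n : ℕ} {V W : Opens X} {x y : Fin (n + 1) → ι} (hxy : x = y)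
    (s : ((cechSheaf U M).X n).val.obj (op V)) (hx : W ≤ V ⊓ inter U x) (hy : W ≤ V ⊓ inter U y) :
    res M hx (comp U M x s) = res M hy (comp U M y s) := by
  subst hxy; rfl

lemma inter_cons_le {n : ℕ} {V : Opens X} (i : ι) (hi : V ≤ U i) (x : Fin (n + 1) → ι) :
    V ⊓ inter U x ≤ V ⊓ inter U (Fin.cons i x : Fin (n + 2) → ι) := by
  refine le_inf inf_le_left ?_
  rw [inter_eq, inter_eq]
  refine le_iInf fun j => ?_
  cases j using Fin.cases with
  | zero => exact inf_le_left.trans hi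
  | succ j => exact inf_le_right.trans (iInf_le _ j)

lemma res_sum {V W : Opens X} (h : W ≤ V) {α : Type*} (t : Finset α) (c : α → ℤ)
    (f : α → M.val.obj (op V)) :
    res M h (∑ a ∈ t, c a • f a) = ∑ a ∈ t, c a • res M h (f a) := by
  have := map_sum (M.val.map (homOfLE h).op).hom (fun a => c a • f a) t
  simp only [map_zsmul] at this
  exact this

lemma res_id {V : Opens X} {h : V ≤ V} (m : M.val.obj (op V)) : res M h m = m :=
  congr($(M.val.presheaf.map_id (op V)) m)

lemma comp_ε₀ (x : Fin 1 → ι) {V : Opens X} (m : M.val.obj (op V)) :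
    comp U M x ((cechε₀ U M).val.app (op V) m) = res M inf_le_left m := by
  have := cechLift_π U (interFunctorSheaf M)
    (fun x => (resInter M (inter U x) : M ⟶ (interFunctorSheaf M).obj (op (inter U x)))) x
  exact congrArg (evalHom m) this

lemma cechSheaf_local_exact {n : ℕ} {V : Opens X} (i : ι) (hi : V ≤ U i)
    (s : ((cechSheaf U M).X (n + 1)).val.obj (op V))
    (hs : ((cechSheaf U M).d (n + 1) (n + 2)).val.app (op V) s = 0) :
    ∃ t : ((cechSheaf U M).X n).val.obj (op V), ((cechSheaf U M).d n (n + 1)).val.app (op V) t = s := by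
  obtain ⟨t, ht⟩ := comp_exists U M (V := V) (fun x : Fin (n + 1) → ι =>
    res M (inter_cons_le U i hi x) (comp U M (Fin.cons i x : Fin (n + 2) → ι) s))
  refine ⟨t, comp_ext U M fun x => ?_⟩
  have h := congrArg (fun m => res M (inter_cons_le U i hi x)
    (comp U M (Fin.cons i x : Fin (n + 3) → ι) m)) hs
  have h0 : res M (inter_cons_le U i hi x) (comp U M (Fin.cons i x : Fin (n + 3) → ι) 0) = 0 :=
    (congrArg _ (map_zero ((cechπ U (interFunctorSheaf M) _).val.app (op V)).hom)).trans
      (map_zero (M.val.map _).hom)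
  have h1 := h.trans h0
  dsimp only at h1
  rw [comp_d, res_sum, Fin.sum_univ_succ] at h1
  simp only [res_res, Fin.val_zero, Fin.val_succ, pow_zero, pow_succ, mul_neg, mul_one,
    neg_smul, one_smul, Finset.sum_neg_distrib] at h1
  rw [comp_d, ← sub_eq_zero, ← neg_eq_zero, neg_sub, ← h1, sub_eq_add_neg]
  congr 1
  · have h2 := comp_congr U M (n := n + 1) (V := V) (W := V ⊓ inter U x) (x := x)
      (y := (Fin.cons i x : Fin (n + 3) → ι) ∘ Fin.succAbove 0) (by
        funext a; simp) s le_rfl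
        ((inter_cons_le U i hi x).trans (inf_le_inf_left V (inter_le_succAbove U _ _)))
    exact (res_id M _).symm.trans h2
  · congr 1
    refine Finset.sum_congr rfl fun j _ => ?_
    rw [ht, res_res]
    congr 1
    apply comp_congr
    funext a
    cases a using Fin.cases <;> simp

lemma cechSheaf_local_exact_zero {V : Opens X} (i : ι) (hi : V ≤ U i)
    (s : ((cechSheaf U M).X 0).val.obj (op V))
    (hs : ((cechSheaf U M).d 0 1).val.app (op V) s = 0) :
    ∃ t : M.val.obj (op V), (cechε₀ U M).val.app (op V) t = s := by
  have hV : V ≤ V ⊓ inter U (fun _ : Fin 1 => i) := by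
    rw [inter_eq]
    exact le_inf le_rfl (le_iInf fun _ => hi)
  refine ⟨res M hV (comp U M (fun _ => i) s), comp_ext U M fun x => ?_⟩
  have h := congrArg (fun m => res M (inter_cons_le U i hi x)
    (comp U M (Fin.cons i x : Fin 2 → ι) m)) hs
  have h0 : res M (inter_cons_le U i hi x) (comp U M (Fin.cons i x : Fin 2 → ι) 0) = 0 :=
    (congrArg _ (map_zero ((cechπ U (interFunctorSheaf M) _).val.app (op V)).hom)).trans
      (map_zero (M.val.map _).hom)
  have h1 := h.trans h0
  dsimp only at h1
  rw [comp_d, res_sum, Fin.sum_univ_two] at h1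
  simp only [res_res, Fin.val_zero, Fin.val_one, pow_zero, pow_one,
    neg_smul, one_smul, ← sub_eq_add_neg] at h1
  have h2 := comp_congr U M (n := 0) (V := V) (W := V ⊓ inter U x) (x := x)
    (y := (Fin.cons i x : Fin 2 → ι) ∘ Fin.succAbove 0) (by
        funext a; simp) s le_rfl
        ((inter_cons_le U i hi x).trans (inf_le_inf_left V (inter_le_succAbove U _ _)))
  have h3 := comp_congr U M (n := 0) (V := V) (W := V ⊓ inter U x) (x := fun _ => i)
    (y := (Fin.cons i x : Fin 2 → ι) ∘ Fin.succAbove 1) (by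
        funext a; fin_cases a; rfl) s (inf_le_left.trans hV)
        ((inter_cons_le U i hi x).trans (inf_le_inf_left V (inter_le_succAbove U _ _)))
  refine (comp_ε₀ U M x _).trans ((res_res M _ _ _).trans ?_)
  exact h3.trans ((sub_eq_zero.1 h1).symm.trans (h2.symm.trans (res_id M _)))

lemma cechε₀_local_mono {V : Opens X} (i : ι) (hi : V ≤ U i) (m : M.val.obj (op V))
    (hm : (cechε₀ U M).val.app (op V) m = 0) : m = 0 := by
  have hV : V ≤ V ⊓ inter U (fun _ : Fin 1 => i) := by
    rw [inter_eq]
    exact le_inf le_rfl (le_iInf fun _ => hi)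
  have h := congrArg (fun s => res M hV (comp U M (fun _ => i) s)) hm
  refine (res_id M _).symm.trans ((res_res M _ hV m).symm.trans ((congrArg (res M hV)
    (comp_ε₀ U M (fun _ => i) m)).symm.trans (h.trans ?_)))
  exact (congrArg _ (map_zero ((cechπ U (interFunctorSheaf M) _).val.app (op V)).hom)).trans
      (map_zero (M.val.map _).hom)

variable {U}

lemma cechSheaf_exact (hU : IsOpenCover U) (n : ℕ) : (cechSheaf U M).ExactAt (n + 1) := by
  rw [HomologicalComplex.exactAt_iff' _ n (n + 1) (n + 1 + 1) (by simp) (by simp)]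
  apply exact_of_locally
  intro V s hs p hp
  obtain ⟨i, hi⟩ := hU.exists_mem p
  refine ⟨V ⊓ U i, inf_le_left, ⟨hp, hi⟩, ?_⟩
  apply cechSheaf_local_exact U M i inf_le_right
  refine (app_res ((cechSheaf U M).d (n + 1) (n + 2)) _ s).trans ?_
  exact (congrArg _ hs).trans (map_zero (((cechSheaf U M).X (n + 2)).val.map _).hom)

lemma cechε_quasiIso (hU : IsOpenCover U) : QuasiIso (cechε U M) := by
  constructor
  intro n
  cases n with
  | zero =>
    rw [CochainComplex.quasiIsoAt₀_iff, ShortComplex.quasiIso_iff_of_zeros]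
    · refine (ShortComplex.exact_and_mono_f_iff_of_iso (S₂ := ShortComplex.mk _ _ (cechε₀_d U M)) ?_).2
        ⟨?_, ?_⟩
      · exact ShortComplex.isoMk (Iso.refl _) (Iso.refl _) (Iso.refl _) (by
          simp [cechε]
          exact (Category.id_comp (cechε₀ U M)).trans (Category.comp_id (cechε₀ U M)).symm)
          (by
            simp
            exact (Category.id_comp ((cechSheaf U M).d 0 1)).trans
              (Category.comp_id ((cechSheaf U M).d 0 1)).symm)
      · apply exact_of_locally
        intro V s hs p hp
        obtain ⟨i, hi⟩ := hU.exists_mem p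
        refine ⟨V ⊓ U i, inf_le_left, ⟨hp, hi⟩, ?_⟩
        apply cechSheaf_local_exact_zero U M i inf_le_right
        refine (app_res ((cechSheaf U M).d 0 1) _ s).trans ?_
        exact (congrArg _ hs).trans (map_zero (((cechSheaf U M).X 1).val.map _).hom)
      · have : (ShortComplex.mk (0 : M ⟶ M) (cechε₀ U M) zero_comp).Exact := by
          apply exact_of_locally
          intro V s hs p hp
          obtain ⟨i, hi⟩ := hU.exists_mem p
          refine ⟨V ⊓ U i, inf_le_left, ⟨hp, hi⟩, 0, ?_⟩
          refine (map_zero _).trans (cechε₀_local_mono U M i inf_le_right _ ?_).symm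
          refine (app_res (cechε₀ U M) _ s).trans ?_
          exact (congrArg _ hs).trans (map_zero (((cechSheaf U M).X 0).val.map _).hom)
        exact (ShortComplex.exact_iff_mono _ rfl).1 this
    all_goals rfl
  | succ n =>
    rw [quasiIsoAt_iff_exactAt]
    · exact cechSheaf_exact M hU n
    · apply CochainComplex.exactAt_succ_single_obj

end Resolution

end Exactness


section Cohomology

variable {k : Type u} [CommRing k] (K : CochainComplex (ModuleCat.{u} k) ℕ) (n : ℕ)

/-- The cocycles of degree `n`. -/
abbrev Cocycles : Submodule k (K.X n) := LinearMap.ker (K.d n (n + 1)).hom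

/-- The cohomology class of a cocycle. -/
def cohomologyClass : Cocycles K n →ₗ[k] K.homology n :=
  (K.liftCycles (ModuleCat.ofHom (Cocycles K n).subtype) (n + 1) (by simp)
    (by ext z; exact z.2) ≫ K.homologyπ n).hom

lemma iCycles_liftCycles (z : Cocycles K n) :
    K.iCycles n (K.liftCycles (ModuleCat.ofHom (Cocycles K n).subtype) (n + 1) (by simp)
      (by ext z; exact z.2) z) = z :=
  congr($(K.liftCycles_i (ModuleCat.ofHom (Cocycles K n).subtype) (n + 1) (by simp)
      (by ext z; exact z.2)) z)

lemma iCycles_injective : Function.Injective (K.iCycles n) :=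
  (ModuleCat.mono_iff_injective _).1 inferInstance

lemma cohomologyClass_surjective : Function.Surjective (cohomologyClass K n) := by
  intro c
  obtain ⟨z, rfl⟩ := (ModuleCat.epi_iff_surjective (K.homologyπ n)).1 inferInstance c
  refine ⟨⟨K.iCycles n z, congr($(K.iCycles_d n (n + 1)) z)⟩, ?_⟩
  refine congrArg (K.homologyπ n) (iCycles_injective K n ?_)
  exact iCycles_liftCycles K n _

lemma exists_of_cohomologyClass_eq_zero (z : Cocycles K n) (hz : cohomologyClass K n z = 0) :
    ∃ y, K.d ((ComplexShape.up ℕ).prev n) n y = z := by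
  have h := ShortComplex.exact_of_g_is_cokernel
    (ShortComplex.mk _ _ (K.toCycles_comp_homologyπ ((ComplexShape.up ℕ).prev n) n))
    (K.homologyIsCokernel ((ComplexShape.up ℕ).prev n) n rfl)
  rw [ShortComplex.moduleCat_exact_iff] at h
  obtain ⟨y, hy⟩ := h _ hz
  exact ⟨y, congr($(K.toCycles_i ((ComplexShape.up ℕ).prev n) n) y).symm.trans
    ((congrArg (K.iCycles n) hy).trans (iCycles_liftCycles K n z))⟩

lemma d_mem {m n : ℕ} (y : K.X m) : K.d m n y ∈ Cocycles K n :=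
  congr($(K.d_comp_d m n (n + 1)) y)

variable {K n} in
lemma ker_cohomologyClass_le {N : Type*} [AddCommGroup N] [Module k N] (φ : Cocycles K n →ₗ[k] N)
    (hφ : ∀ (m : ℕ), m + 1 = n → ∀ y : K.X m, φ ⟨K.d m n y, d_mem K y⟩ = 0) :
    LinearMap.ker (cohomologyClass K n) ≤ LinearMap.ker φ := by
  intro z hz
  obtain ⟨y, hy⟩ := exists_of_cohomologyClass_eq_zero K n z hz
  by_cases h : (ComplexShape.up ℕ).prev n + 1 = n
  · rw [LinearMap.mem_ker, ← hφ _ h y]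
    exact congrArg φ (Subtype.ext hy.symm)
  · have hz0 : z = 0 := by
      apply Subtype.ext
      rw [← hy, K.shape _ _ h]
      rfl
    rw [hz0]
    exact zero_mem _

/-- A linear map on cocycles which vanishes on coboundaries, as a linear map on cohomology. -/
def descend {K : CochainComplex (ModuleCat.{u} k) ℕ} {n : ℕ}
    {N : Type*} [AddCommGroup N] [Module k N] (φ : Cocycles K n →ₗ[k] N)
    (hφ : ∀ (m : ℕ), m + 1 = n → ∀ y : K.X m, φ ⟨K.d m n y, d_mem K y⟩ = 0) :
    K.homology n →ₗ[k] N :=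
  (LinearMap.ker (cohomologyClass K n)).liftQ φ (ker_cohomologyClass_le φ hφ) ∘ₗ
    ((cohomologyClass K n).quotKerEquivOfSurjective (cohomologyClass_surjective K n)).symm.toLinearMap

lemma descend_cohomologyClass {N : Type*} [AddCommGroup N] [Module k N] (φ : Cocycles K n →ₗ[k] N)
    (hφ : ∀ (m : ℕ), m + 1 = n → ∀ y : K.X m, φ ⟨K.d m n y, d_mem K y⟩ = 0) (z : Cocycles K n) :
    descend φ hφ (cohomologyClass K n z) = φ z := by
  have h : ((cohomologyClass K n).quotKerEquivOfSurjective (cohomologyClass_surjective K n)).symm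
      (cohomologyClass K n z) = Submodule.Quotient.mk z := by
    rw [LinearEquiv.symm_apply_eq]
    rfl
  change (LinearMap.ker (cohomologyClass K n)).liftQ φ (ker_cohomologyClass_le φ hφ) _ = _
  erw [h]
  rfl

end Cohomology

section CechCohomology

variable {X : TopCat.{u}} {k : Type u} [CommRing k] {ι : Type u} (U : ι → Opens X) (M : Mod X k)

/-- The Čech complex of `M`, as a complex of `k`-modules. -/
abbrev cechComplex : CochainComplex (ModuleCat.{u} k) ℕ := cech U (kPresheaf M)

/-- The Čech cohomology of `M`. -/
abbrev CechCohomology (n : ℕ) : ModuleCat.{u} k := (cechComplex U M).homology n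

/-- The value of a Čech cochain at `(i₀, …, iₙ)`. -/
def value {n : ℕ} (x : Fin (n + 1) → ι) : (cechComplex U M).X n →ₗ[k]
    (kPresheaf M).obj (op (inter U x)) :=
  (cechπ U (kPresheaf M) x).hom

lemma value_ext {n : ℕ} {α β : (cechComplex U M).X n}
    (h : ∀ x, value U M x α = value U M x β) : α = β := by
  have : ModuleCat.ofHom (LinearMap.toSpanSingleton k _ α) =
      ModuleCat.ofHom (LinearMap.toSpanSingleton k _ β) := by
    apply cech_hom_ext
    intro x
    ext
    change value U M x ((1 : k) • α) = value U M x ((1 : k) • β)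
    rw [one_smul, one_smul, h x]
  simpa using congr($(this).hom (1 : k))

/-- The morphism from `k` which sends `1` to a given element. -/
def pointHom (N : ModuleCat.{u} k) (m : N) : ModuleCat.of k k ⟶ N :=
  ModuleCat.ofHom (LinearMap.toSpanSingleton k N m)

/-- The Čech cochain with given values. -/
def mkCochain {n : ℕ} (f : ∀ x : Fin (n + 1) → ι, (kPresheaf M).obj (op (inter U x))) :
    (cechComplex U M).X n :=
  (cechLift U (kPresheaf M) (T := ModuleCat.of k k)
    (fun x => pointHom _ (f x))).hom (1 : k)

lemma value_mkCochain {n : ℕ} (f : ∀ x : Fin (n + 1) → ι, (kPresheaf M).obj (op (inter U x)))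
    (x : Fin (n + 1) → ι) : value U M x (mkCochain U M f) = f x := by
  have := cechLift_π U (kPresheaf M) (T := ModuleCat.of k k)
    (fun x => pointHom _ (f x)) x
  exact congr($(this).hom (1 : k)).trans (one_smul k (f x))

/-- Restriction of sections, as a `k`-linear map. -/
def resK {V W : Opens X} (h : W ≤ V) :
    (kPresheaf M).obj (op V) →ₗ[k] (kPresheaf M).obj (op W) :=
  ((kPresheaf M).map (homOfLE h).op).hom

lemma resK_resK {V V' W : Opens X} (h : V' ≤ V) (h' : W ≤ V') (m : (kPresheaf M).obj (op V)) :
    resK M h' (resK M h m) = resK M (h'.trans h) m :=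
  res_res M h h' m

lemma value_d {n : ℕ} (x : Fin (n + 2) → ι) (α : (cechComplex U M).X n) :
    value U M x ((cechComplex U M).d n (n + 1) α) =
      ∑ j : Fin (n + 2), (-1 : ℤ) ^ (j : ℕ) •
        resK M (inter_le_succAbove U x j) (value U M (x ∘ j.succAbove) α) := by
  have h := congrArg (fun f => f.hom α) (cech_d_π U (kPresheaf M) x)
  simp only [ModuleCat.hom_sum, ModuleCat.hom_zsmul, LinearMap.sum_apply,
    LinearMap.smul_apply] at h
  exact h

/-- The restriction to `W` of the value of a Čech cochain at `x`. -/
def valueRes {n : ℕ} {W : Opens X} (x : Fin (n + 1) → ι) (hW : W ≤ inter U x) :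
    (cechComplex U M).X n →ₗ[k] (kPresheaf M).obj (op W) :=
  resK M hW ∘ₗ value U M x

variable {U M}

lemma valueRes_congr {n : ℕ} {W : Opens X} {x y : Fin (n + 1) → ι} (hxy : x = y)
    (hx : W ≤ inter U x) (hy : W ≤ inter U y) (α : (cechComplex U M).X n) :
    valueRes U M x hx α = valueRes U M y hy α := by
  subst hxy; rfl

lemma resK_valueRes {n : ℕ} {W W' : Opens X} {x : Fin (n + 1) → ι}
    (hx : W ≤ inter U x) (h : W' ≤ W) (α : (cechComplex U M).X n) :
    resK M h (valueRes U M x hx α) = valueRes U M x (h.trans hx) α :=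
  resK_resK M _ _ _

lemma valueRes_d {n : ℕ} {W : Opens X} (x : Fin (n + 2) → ι) (hx : W ≤ inter U x)
    (α : (cechComplex U M).X n) :
    valueRes U M x hx ((cechComplex U M).d n (n + 1) α) =
      ∑ j : Fin (n + 2), (-1 : ℤ) ^ (j : ℕ) •
        valueRes U M (x ∘ j.succAbove) (hx.trans (inter_le_succAbove U x j)) α := by
  refine (congrArg (resK M hx) (value_d U M x α)).trans ?_
  rw [map_sum]
  refine Finset.sum_congr rfl fun j _ => ?_
  rw [map_zsmul, resK_resK]
  rfl

lemma inter_le_comp {m n : ℕ} (x : Fin (n + 1) → ι) (g : Fin (m + 1) → Fin (n + 1)) :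
    inter U x ≤ inter U (x ∘ g) := by
  rw [inter_eq, inter_eq]
  exact le_iInf fun i => iInf_le _ _

variable (M) in
/-- `(m, r) ↦ r • m`, for `m` a section of `M` and `r` a section of `k_X`. -/
def sectionSmul (V : (Opens X)ᵒᵖ) (m : (kPresheaf M).obj V)
    (r : (kPresheaf (constMod X k)).obj V) : (kPresheaf M).obj V :=
  HSMul.hSMul (α := Sec X k V) (β := M.val.obj V) (γ := M.val.obj V) r m

variable (M) in
/-- The `k`-bilinear map `(m, r) ↦ r • m`. -/
def sectionMul (V : (Opens X)ᵒᵖ) :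
    (kPresheaf M).obj V →ₗ[k] (kPresheaf (constMod X k)).obj V →ₗ[k] (kPresheaf M).obj V :=
  LinearMap.mk₂ k (sectionSmul M V)
    (fun m m' r => smul_add (M := Sec X k V) (A := M.val.obj V) r m m')
    (fun a m r => by
      refine (smul_smul (α := M.val.obj V) (M := Sec X k V) r (constSec X k V a) m).trans
        (Eq.trans ?_ (smul_smul (α := M.val.obj V) (M := Sec X k V) (constSec X k V a) r m).symm)
      exact congrArg (fun t : Sec X k V =>
        HSMul.hSMul (α := Sec X k V) (β := M.val.obj V) (γ := M.val.obj V) t m)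
        (sec_mul_comm X k r (constSec X k V a)))
    (fun m r r' => add_smul (R := Sec X k V) (M := M.val.obj V) r r' m)
    (fun a m r => mul_smul (α := Sec X k V) (β := M.val.obj V) (constSec X k V a) r m)

lemma resK_sectionMul {V W : Opens X} (h : W ≤ V) (m : (kPresheaf M).obj (op V))
    (r : (kPresheaf (constMod X k)).obj (op V)) :
    resK M h (sectionMul M (op V) m r) =
      sectionMul M (op W) (resK M h m) (resK (constMod X k) h r) :=
  res_smul M h r m

variable (U)

/-- `(i₀, …, iₙ) ↦ (i₀, …, i_q)`, where `q + p = n`. -/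
def front {q p n : ℕ} (h : q + p = n) (x : Fin (n + 1) → ι) : Fin (q + 1) → ι :=
  x ∘ fun j => ⟨j, by omega⟩

/-- `(i₀, …, iₙ) ↦ (i_q, …, iₙ)`, where `q + p = n`. -/
def back {q p n : ℕ} (h : q + p = n) (x : Fin (n + 1) → ι) : Fin (p + 1) → ι :=
  x ∘ fun j => ⟨q + j, by omega⟩

lemma inter_le_front {q p n : ℕ} (h : q + p = n) (x : Fin (n + 1) → ι) :
    inter U x ≤ inter U (front h x) := inter_le_comp x _

lemma inter_le_back {q p n : ℕ} (h : q + p = n) (x : Fin (n + 1) → ι) :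
    inter U x ≤ inter U (back h x) := inter_le_comp x _

variable (M)

/-- The value at `x` of the cup product of Čech cochains:
`α(i₀, …, i_q) β(i_q, …, iₙ)`, restricted to `U_{i₀} ∩ ⋯ ∩ U_{iₙ}`. -/
def cupValue {q p n : ℕ} (h : q + p = n) (x : Fin (n + 1) → ι)
    (α : (cechComplex U M).X q) (β : (cechComplex U (constMod X k)).X p) :
    (kPresheaf M).obj (op (inter U x)) :=
  sectionMul M (op (inter U x)) (valueRes U M (front h x) (inter_le_front U h x) α)
    (valueRes U (constMod X k) (back h x) (inter_le_back U h x) β)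

/-- The cup product of Čech cochains. -/
def cupCochain {q p n : ℕ} (h : q + p = n) :
    (cechComplex U M).X q →ₗ[k] (cechComplex U (constMod X k)).X p →ₗ[k] (cechComplex U M).X n :=
  LinearMap.mk₂ k (Pₗ := (cechComplex U M).X n) (fun α β => mkCochain U M fun x => cupValue U M h x α β)
    (fun α α' β => value_ext U M fun x => by
      rw [map_add, value_mkCochain, value_mkCochain, value_mkCochain]
      simp only [cupValue, map_add, LinearMap.add_apply])
    (fun a α β => value_ext U M fun x => by
      rw [map_smul, value_mkCochain, value_mkCochain]
      simp only [cupValue, map_smul, LinearMap.smul_apply])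
    (fun α β β' => value_ext U M fun x => by
      rw [map_add, value_mkCochain, value_mkCochain, value_mkCochain]
      simp only [cupValue, map_add])
    (fun a α β => value_ext U M fun x => by
      rw [map_smul, value_mkCochain, value_mkCochain]
      simp only [cupValue, map_smul])

lemma value_cupCochain {q p n : ℕ} (h : q + p = n) (x : Fin (n + 1) → ι)
    (α : (cechComplex U M).X q) (β : (cechComplex U (constMod X k)).X p) :
    value U M x (cupCochain U M h α β) = cupValue U M h x α β :=
  value_mkCochain U M _ x

variable {U M}

lemma resK_cupValue {q p n : ℕ} (h : q + p = n) {W : Opens X} (x : Fin (n + 1) → ι)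
    (hx : W ≤ inter U x)
    (α : (cechComplex U M).X q) (β : (cechComplex U (constMod X k)).X p) :
    resK M hx (cupValue U M h x α β) =
      sectionMul M (op W) (valueRes U M (front h x) (hx.trans (inter_le_front U h x)) α)
        (valueRes U (constMod X k) (back h x) (hx.trans (inter_le_back U h x)) β) := by
  rw [cupValue, resK_sectionMul, resK_valueRes, resK_valueRes]

lemma sectionMul_valueRes_congr {q p : ℕ} {W : Opens X} {x x' : Fin (q + 1) → ι}
    {y y' : Fin (p + 1) → ι} (hx : x = x') (hy : y = y') (h₁ : W ≤ inter U x)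
    (h₁' : W ≤ inter U x') (h₂ : W ≤ inter U y) (h₂' : W ≤ inter U y')
    (α : (cechComplex U M).X q) (β : (cechComplex U (constMod X k)).X p) :
    sectionMul M (op W) (valueRes U M x h₁ α) (valueRes U (constMod X k) y h₂ β) =
      sectionMul M (op W) (valueRes U M x' h₁' α) (valueRes U (constMod X k) y' h₂' β) := by
  subst hx hy; rfl

/-- The Leibniz rule. -/
lemma d_cupCochain {q p : ℕ}
    (α : (cechComplex U M).X q) (β : (cechComplex U (constMod X k)).X p) :
    (cechComplex U M).d (q + p) (q + p + 1) (cupCochain U M rfl α β) =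
      cupCochain U M (by omega) ((cechComplex U M).d q (q + 1) α) β +
      (-1 : ℤ) ^ q • cupCochain U M (by omega) α
        ((cechComplex U (constMod X k)).d p (p + 1) β) := by
  apply value_ext
  intro x
  rw [map_add, map_zsmul, value_d, value_cupCochain, value_cupCochain]
  unfold cupValue
  rw [valueRes_d, valueRes_d, Fin.sum_univ_castSucc (n := q + 1), Fin.sum_univ_succ (n := p + 1)]
  simp only [value_cupCochain, resK_cupValue]
  rw [← Fin.sum_congr' _ (show (q + 1) + (p + 1) = q + p + 2 by omega), Fin.sum_univ_add]
  simp only [map_add, map_sum, map_zsmul, LinearMap.add_apply, LinearMap.sum_apply,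
    LinearMap.smul_apply, smul_add, Finset.smul_sum]
  have e : ∀ a b c d e f : (kPresheaf M).obj (op (inter U x)), a = c → b = f → d + e = 0 →
      a + b = (c + d) + (e + f) := by
    rintro a b _ d e _ rfl rfl h
    calc a + b = a + b + (d + e) := by rw [h, add_zero]
      _ = _ := by abel
  apply e
  · refine Finset.sum_congr rfl fun j _ => ?_
    refine congrArg₂ _ rfl (sectionMul_valueRes_congr ?_ ?_ _ _ _ _ α β)
    · funext a
      refine congrArg x (Fin.ext ?_)
      simp only [Fin.succAbove, Fin.lt_def, Fin.val_castSucc, Fin.val_cast, Fin.val_castAdd]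
      split_ifs <;> simp
    · funext a
      refine congrArg x (Fin.ext ?_)
      simp only [Fin.succAbove, Fin.lt_def, Fin.val_castSucc, Fin.val_cast, Fin.val_castAdd]
      split_ifs <;> simp <;> omega
  · refine Finset.sum_congr rfl fun j _ => ?_
    rw [smul_smul, ← pow_add]
    refine congrArg₂ _ ?_ (sectionMul_valueRes_congr ?_ ?_ _ _ _ _ α β)
    · congr 1
      simp only [Fin.val_cast, Fin.val_natAdd, Fin.val_succ]
      omega
    · funext a
      refine congrArg x (Fin.ext ?_)
      simp only [Fin.succAbove, Fin.lt_def, Fin.val_castSucc, Fin.val_cast, Fin.val_natAdd]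
      split_ifs <;> simp <;> omega
    · funext a
      refine congrArg x (Fin.ext ?_)
      simp only [Fin.succAbove, Fin.lt_def, Fin.val_castSucc, Fin.val_cast, Fin.val_natAdd,
        Fin.val_succ]
      split_ifs <;> simp <;> omega
  · have h₁ : q + (p + 1) = q + p + 1 := rfl
    have h₂ : q + 1 + p = q + p + 1 := by omega
    have e₁ : front h₂ x ∘ (Fin.last (q + 1)).succAbove = front h₁ x := by
      funext a
      refine congrArg x (Fin.ext ?_)
      simp
    have e₂ : back h₁ x ∘ Fin.succAbove 0 = back h₂ x := by
      funext a
      refine congrArg x (Fin.ext ?_)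
      simp
      omega
    rw [sectionMul_valueRes_congr e₁ rfl _ (inter_le_front U h₁ x) _ (inter_le_back U h₂ x),
      sectionMul_valueRes_congr rfl e₂ _ (inter_le_front U h₁ x) _ (inter_le_back U h₂ x)]
    simp [pow_succ]

lemma cocycle_d {n : ℕ} {K : CochainComplex (ModuleCat.{u} k) ℕ} (z : Cocycles K n) :
    K.d n (n + 1) z = 0 := z.2

lemma cupCochain_mem {q p n : ℕ} (h : q + p = n) (α : Cocycles (cechComplex U M) q)
    (β : Cocycles (cechComplex U (constMod X k)) p) :
    cupCochain U M h α β ∈ Cocycles (cechComplex U M) n := by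
  subst h
  refine (d_cupCochain (α : (cechComplex U M).X q)
    (β : (cechComplex U (constMod X k)).X p)).trans ?_
  rw [cocycle_d, cocycle_d, map_zero, map_zero, LinearMap.zero_apply, smul_zero, add_zero]

lemma cohomologyClass_d {m n : ℕ} (_hm : m + 1 = n) {K : CochainComplex (ModuleCat.{u} k) ℕ}
    (y : K.X m) (z : Cocycles K n) (hz : K.d m n y = z) : cohomologyClass K n z = 0 := by
  have h := K.toCycles_comp_homologyπ m n
  have h' : K.liftCycles (ModuleCat.ofHom (Cocycles K n).subtype) (n + 1) (by simp)
      (by ext z; exact z.2) z = K.toCycles m n y := by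
    apply iCycles_injective
    rw [iCycles_liftCycles]
    exact hz.symm.trans congr($(K.toCycles_i m n) y).symm
  exact (congrArg (K.homologyπ n) h').trans congr($h y)

variable (U M) in
/-- The cohomology class of the cup product of two cocycles. -/
def cupClass {q p n : ℕ} (h : q + p = n) :
    Cocycles (cechComplex U M) q →ₗ[k] Cocycles (cechComplex U (constMod X k)) p →ₗ[k]
      CechCohomology U M n :=
  LinearMap.mk₂ k (fun α β => cohomologyClass (cechComplex U M) n
      ⟨cupCochain U M h α β, cupCochain_mem h α β⟩)
    (fun α α' β => by
      rw [← map_add]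
      exact congrArg _ (Subtype.ext (LinearMap.map_add₂ (cupCochain U M h) _ _ _)))
    (fun a α β => by
      rw [← map_smul]
      exact congrArg _ (Subtype.ext (LinearMap.map_smul₂ (cupCochain U M h) _ _ _)))
    (fun α β β' => by
      rw [← map_add]
      exact congrArg _ (Subtype.ext (map_add (cupCochain U M h α) _ _)))
    (fun a α β => by
      rw [← map_smul]
      exact congrArg _ (Subtype.ext (map_smul (cupCochain U M h α) _ _)))

lemma cupClass_apply {q p n : ℕ} (h : q + p = n) (α : Cocycles (cechComplex U M) q)
    (β : Cocycles (cechComplex U (constMod X k)) p) :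
    cupClass U M h α β = cohomologyClass (cechComplex U M) n
      ⟨cupCochain U M h α β, cupCochain_mem h α β⟩ := rfl

lemma cupClass_d_left {q p n : ℕ} (h : q + p = n) {m : ℕ} (hm : m + 1 = q)
    (α : (cechComplex U M).X m) (β : Cocycles (cechComplex U (constMod X k)) p) :
    cupClass U M h ⟨(cechComplex U M).d m q α, d_mem _ α⟩ β = 0 := by
  subst hm
  obtain rfl : n = m + p + 1 := by omega
  refine cohomologyClass_d rfl (cupCochain U M rfl α β) _ ?_
  refine (d_cupCochain α (β : (cechComplex U (constMod X k)).X p)).trans ?_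
  rw [cocycle_d, map_zero, smul_zero, add_zero]

lemma cupClass_d_right {q p n : ℕ} (h : q + p = n) {m : ℕ} (hm : m + 1 = p)
    (α : Cocycles (cechComplex U M) q) (β : (cechComplex U (constMod X k)).X m) :
    cupClass U M h α ⟨(cechComplex U (constMod X k)).d m p β, d_mem _ β⟩ = 0 := by
  subst hm
  obtain rfl : n = q + m + 1 := by omega
  refine cohomologyClass_d rfl ((-1 : ℤ) ^ q • cupCochain U M rfl α β) _ ?_
  rw [map_zsmul]
  refine (congrArg _ (d_cupCochain (α : (cechComplex U M).X q) β)).trans ?_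
  rw [cocycle_d, map_zero, LinearMap.zero_apply, zero_add, smul_smul, ← mul_pow]
  simp

variable (U M) in
/-- The Čech cup product `Ȟ^q(U, M) → Ȟ^p(U, k_X) → Ȟ^n(U, M)`, where `q + p = n`. -/
def cechCupBilinear {q p n : ℕ} (h : q + p = n) :
    CechCohomology U M q →ₗ[k] CechCohomology U (constMod X k) p →ₗ[k] CechCohomology U M n :=
  descend (LinearMap.flip (descend (cupClass U M h).flip (fun m hm β => by
      ext α
      exact cupClass_d_right h hm α β)))
    (fun m hm α => by
      ext b
      obtain ⟨β, rfl⟩ := cohomologyClass_surjective _ _ b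
      rw [LinearMap.flip_apply, descend_cohomologyClass]
      exact cupClass_d_left h hm α β)

lemma cechCupBilinear_apply {q p n : ℕ} (h : q + p = n) (α : Cocycles (cechComplex U M) q)
    (β : Cocycles (cechComplex U (constMod X k)) p) :
    cechCupBilinear U M h (cohomologyClass _ q α) (cohomologyClass _ p β) =
      cohomologyClass _ n ⟨cupCochain U M h α β, cupCochain_mem h α β⟩ := by
  rw [cechCupBilinear, descend_cohomologyClass, LinearMap.flip_apply, descend_cohomologyClass]
  rfl

variable (U M) in
/-- The Čech cup product `Ȟ^q(U, M) ⊗ Ȟ^p(U, k_X) → Ȟ^n(U, M)`, where `q + p = n`. -/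
def cechCup {q p n : ℕ} (h : q + p = n) :
    TensorProduct k (CechCohomology U M q) (CechCohomology U (constMod X k) p) →ₗ[k]
      CechCohomology U M n :=
  TensorProduct.lift (cechCupBilinear U M h)

end CechCohomology

section Comparison

open Abelian

variable {X : TopCat.{u}} {k : Type u} [CommRing k] {ι : Type u} (U : ι → Opens X) (M : Mod X k)

lemma cechLift_comp_add {n : ℕ} {T : Mod X k} {P : (Opens X)ᵒᵖ ⥤ Mod X k}
    (f g : ∀ x : Fin (n + 1) → ι, T ⟶ P.obj (op (inter U x))) :
    cechLift U P (fun x => f x + g x) = cechLift U P f + cechLift U P g :=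
  cech_hom_ext U P fun x => by
    rw [Preadditive.add_comp, cechLift_π, cechLift_π, cechLift_π]

lemma cechLift_comp_smul {n : ℕ} {T : Mod X k} {P : (Opens X)ᵒᵖ ⥤ Mod X k} (a : k)
    (f : ∀ x : Fin (n + 1) → ι, T ⟶ P.obj (op (inter U x))) :
    cechLift U P (fun x => a • f x) = a • cechLift U P f :=
  cech_hom_ext U P fun x => by
    rw [Linear.smul_comp, cechLift_π, cechLift_π]

/-- A section of `M` over `W`, as a morphism from `k_X`. -/
def sectionHom' (W : (Opens X)ᵒᵖ) :
    (kPresheaf M).obj W →ₗ[k] (constMod X k ⟶ (interFunctorSheaf M).obj W) :=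
  sectionHom M W.unop

/-- A Čech cochain of `M`, as a morphism from `k_X` to the Čech resolution of `M`. -/
def cochainHom (n : ℕ) :
    (cechComplex U M).X n →ₗ[k] (constMod X k ⟶ (cechSheaf U M).X n) where
  toFun α := cechLift U (interFunctorSheaf M)
    (fun x => sectionHom' M (op (inter U x)) (value U M x α))
  map_add' α β := by
    simp only [map_add]
    exact cechLift_comp_add U _ _
  map_smul' a α := by
    simp only [map_smul]
    exact cechLift_comp_smul U a _

lemma cochainHom_π {n : ℕ} (x : Fin (n + 1) → ι) (α : (cechComplex U M).X n) :
    cochainHom U M n α ≫ cechπ U (interFunctorSheaf M) x =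
      sectionHom' M (op (inter U x)) (value U M x α) :=
  cechLift_π U _ _ x

lemma cochainHom_d (n : ℕ) (α : (cechComplex U M).X n) :
    cochainHom U M n α ≫ (cechSheaf U M).d n (n + 1) =
      cochainHom U M (n + 1) ((cechComplex U M).d n (n + 1) α) := by
  apply cech_hom_ext
  intro x
  rw [Category.assoc, cech_d_π, cochainHom_π, value_d, map_sum, Preadditive.comp_sum]
  refine Finset.sum_congr rfl fun j _ => ?_
  rw [Preadditive.comp_zsmul, map_zsmul, ← Category.assoc, cochainHom_π]
  exact congrArg _ (sectionHom_naturality M (homOfLE (inter_le_succAbove U x j)).op _)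

/-- Sheaf cohomology `H^n(X, M) = Ext^n(k_X, M)`, in the category of sheaves of `k_X`-modules. -/
abbrev SheafCohomology [HasExt.{w} (Mod X k)] (n : ℕ) : Type w :=
  Ext.{w} (constMod X k) M n

lemma cocycleHom_d {n : ℕ} (z : Cocycles (cechComplex U M) n) :
    cochainHom U M n z ≫ (cechSheaf U M).d n (n + 1) = 0 := by
  rw [cochainHom_d, cocycle_d, map_zero]

variable {U}

/-- The image of a Čech cocycle in `Ext^n(k_X, M)`. -/
def cocycleExt [HasExt.{w} (Mod X k)] (hU : IsOpenCover U) (n : ℕ) :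
    Cocycles (cechComplex U M) n →ₗ[k] SheafCohomology.{w} M n :=
  letI := cechε_quasiIso M hU
  { toFun z := extClass.{w} (cechε U M) (cochainHom U M n z) (cocycleHom_d U M z)
    map_add' z z' := by
      rw [← extClass_add]
      congr 1
      exact map_add (cochainHom U M n) _ _
    map_smul' a z := by
      rw [RingHom.id_apply, ← extClass_smul]
      congr 1
      exact map_smul (cochainHom U M n) a _ }

/-- The canonical morphism from Čech cohomology to sheaf cohomology. -/
def cechToSheaf [HasExt.{w} (Mod X k)] (hU : IsOpenCover U) (n : ℕ) :
    CechCohomology U M n →ₗ[k] SheafCohomology.{w} M n :=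
  descend (cocycleExt M hU n) (fun m hm α => by
    subst hm
    let := cechε_quasiIso M hU
    refine Eq.trans ?_ (extClass_d (cechε U M) rfl (cochainHom U M m α))
    change extClass (cechε U M) _ _ = _
    congr 1
    exact (cochainHom_d U M m α).symm)

lemma cechToSheaf_apply [HasExt.{w} (Mod X k)] (hU : IsOpenCover U) (n : ℕ)
    (z : Cocycles (cechComplex U M) n) :
    letI := cechε_quasiIso M hU
    cechToSheaf M hU n (cohomologyClass _ n z) =
      extClass.{w} (cechε U M) (cochainHom U M n z) (cocycleHom_d U M z) :=
  descend_cohomologyClass _ _ _ _ _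

/-- The cup product `H^q(X, M) ⊗ H^p(X, k_X) → H^n(X, M)`, given by composition in `Ext`:
`Ext^q(k_X, M) ⊗ Ext^p(k_X, k_X) → Ext^n(k_X, M)`. -/
def extCup [HasExt.{w} (Mod X k)] {q p n : ℕ} (h : q + p = n) :
    TensorProduct k (SheafCohomology.{w} M q) (SheafCohomology.{w} (constMod X k) p) →ₗ[k]
      SheafCohomology.{w} M n :=
  TensorProduct.lift (Ext.bilinearCompOfLinear k (constMod X k) (constMod X k) M p q n
    (by omega)).flip

end Comparison

end CechCup

end

/-!
Let `α` be a Čech cocycle of degree `q` with values in `S` and `β` one of degree `p` with values in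
`k_X`. The cup product with `α` makes sense for sections of the Čech resolution of `k_X`, not only
for Čech cochains, and gives morphisms of sheaves `𝒞ᵐ(U, k_X) ⟶ 𝒞^(q + m)(U, S)` (`cupHom`).
Since `dα = 0`, the Leibniz rule shows that they commute with the differentials up to the sign
`(-1)^q` (`cupHom_d`). This is the sign in the differential of a shifted complex, so they form
a morphism of complexes `α̃ : 𝒞(U, k_X) ⟶ 𝒞(U, S)[q]`. It satisfies:

* `α̃` restricts to `α : k_X ⟶ 𝒞(U, S)[q]` along the augmentation of `𝒞(U, k_X)`
  (`cechε₀_cupHom`);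
* `α̃[p]` takes `β : k_X ⟶ 𝒞(U, k_X)[p]` to `α ∪ β` (`cochainHom_cupHom`).

In the derived category, with `ε` and `ε'` the augmentations of `𝒞(U, S)` and `𝒞(U, k_X)`, this gives
`(ε[q]⁻¹ α)[p] ∘ (ε'[p]⁻¹ β) = ε[q + p]⁻¹ ∘ α̃[p] ∘ ε'[p] ∘ ε'[p]⁻¹ ∘ β = ε[q + p]⁻¹ ∘ (α ∪ β)`.
The last computation is `extClass_comp_extClass`, stated for resolutions in any abelian category.
No further sign appears: the identification of cocycles of degree `n` in the complex of morphisms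
with morphisms to the complex shifted by `n` takes composition to composition
(`equivHomShift_symm_comp`).
-/

noncomputable section

namespace CechCup

/-! ### Composition of classes given by resolutions -/

section ShiftedCochainMap

open CochainComplex HomComplex Abelian

/-- The identification of degree-`n` cocycles with morphisms to a shifted complex takes
composition of cocycles to composition of shifted morphisms. -/
lemma equivHomShift_symm_comp {A : Type u} [Category.{v} A] [Preadditive A]
    {K L M : CochainComplex A ℤ} {p q n : ℤ} (z : Cocycle K L p) (z' : Cocycle L M q)
    (z'' : Cocycle K M n) (h : p + q = n) (hz : z''.1 = z.1.comp z'.1 h) :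
    (Cocycle.equivHomShift.symm z'' : ShiftedHom K M n) =
      ShiftedHom.comp (Cocycle.equivHomShift.symm z) (Cocycle.equivHomShift.symm z')
        (by omega) := by
  ext a
  subst h
  have h1 := Cochain.comp_v z.1 z'.1 rfl a (a + p) (a + (p + q)) rfl (by omega)
  rw [← hz] at h1
  simp [ShiftedHom.comp, Cocycle.equivHomShift_symm_apply,
    Cochain.rightShift_v _ _ _ _ a a (add_zero a) _ rfl]
  rw [CochainComplex.shiftFunctorAdd'_inv_app_f',
    Cochain.rightShift_v z'.1 q 0 (by omega) (a + p) (a + p) (by omega) (a + (p + q)) (by omega), h1]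
  simp only [HomologicalComplex.XIsoOfEq, eqToIso.hom, shiftFunctorObjXIso, eqToIso.inv]
  refine (Category.comp_id _).trans (congrArg₂ (· ≫ ·) (Category.comp_id _).symm ?_)
  refine (Category.comp_id _).symm.trans (Eq.trans ?_ (Category.assoc _ _ _).symm)
  exact congrArg _ ((eqToHom_refl _ rfl).symm.trans (eqToHom_trans _ _).symm)

/-- Composition of shifted morphisms `X ⟶ X' ⟶ Y'[p] ⟶ Y[p]` and `Y ⟶ Y' ⟶ Z'[q] ⟶ Z[q]`, when
`Y' ⟶ Y ⟶ Y'` is the identity. -/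
lemma shiftedHom_comp_of_comp_eq_id {D : Type u} [Category.{v} D] [HasShift D ℤ]
    {X X' Y Y' Z Z' : D} {p q n : ℤ} (h : q + p = n) (a : X ⟶ X') (f : ShiftedHom X' Y' p)
    (e : Y' ⟶ Y) (b : Y ⟶ Y') (g : ShiftedHom Y' Z' q) (c : Z' ⟶ Z) (he : e ≫ b = 𝟙 Y') :
    ShiftedHom.comp (a ≫ f ≫ e⟦p⟧' : ShiftedHom X Y p) (b ≫ g ≫ c⟦q⟧' : ShiftedHom Y Z q) h =
      a ≫ f.comp g h ≫ c⟦n⟧' := by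
  have h1 : e⟦p⟧' ≫ b⟦p⟧' = 𝟙 _ := by rw [← Functor.map_comp, he, CategoryTheory.Functor.map_id]
  simp only [ShiftedHom.comp, Functor.map_comp, Category.assoc, reassoc_of% h1]
  rw [← (shiftFunctorAdd' D q p n h).inv.naturality c]
  rfl

variable {A : Type u} [Category.{v} A] [Abelian A] {K' K : CochainComplex A ℕ} {q : ℕ}

/-- A family of morphisms `K'ᵐ ⟶ K^(q + m)`, extended by zero to negative degrees. -/
def extendCochain (G : ∀ m, K'.X m ⟶ K.X (q + m)) : Cochain (extendInt K') (extendInt K) (q : ℤ) :=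
  Cochain.mk fun a b hab =>
    if h : 0 ≤ a then
      (HomologicalComplex.extendXIso K' ComplexShape.embeddingUpNat
          (show ((a.toNat : ℕ) : ℤ) = a by omega)).hom ≫ G a.toNat ≫
        (HomologicalComplex.extendXIso K ComplexShape.embeddingUpNat
          (show ((q + a.toNat : ℕ) : ℤ) = b by omega)).inv
    else 0

lemma extendCochain_v (G : ∀ m, K'.X m ⟶ K.X (q + m)) (m : ℕ)
    (h : (m : ℤ) + (q : ℤ) = ((q + m : ℕ) : ℤ)) :
    (extendCochain G).v (m : ℤ) ((q + m : ℕ) : ℤ) h =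
      (extendIntXIso K' m).hom ≫ G m ≫ (extendIntXIso K (q + m)).inv := by
  simp [extendCochain, extendIntXIso]

/-- If `G` commutes with the differentials up to the sign `(-1)^q`, then its extension is a
cocycle, that is, a morphism of complexes `K' ⟶ K[q]`. -/
def extendCocycle (G : ∀ m, K'.X m ⟶ K.X (q + m))
    (hG : ∀ m, G m ≫ K.d (q + m) (q + m + 1) =
      (-1 : ℤ) ^ q • K'.d m (m + 1) ≫ G (m + 1)) :
    Cocycle (extendInt K') (extendInt K) (q : ℤ) :=
  Cocycle.mk (extendCochain G) _ rfl (by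
    ext a b hab
    obtain ha | ha := lt_or_ge a 0
    · apply IsZero.eq_of_src
      apply HomologicalComplex.isZero_extend_X
      intro i hi
      simp at hi
      omega
    · obtain ⟨m, rfl⟩ := Int.eq_ofNat_of_zero_le ha
      obtain rfl : b = ((q + m + 1 : ℕ) : ℤ) := by push_cast; omega
      have h1 := extendCochain_v G m (by push_cast; omega)
      have h2 : (extendCochain G).v ((m + 1 : ℕ) : ℤ) ((q + m + 1 : ℕ) : ℤ) (by push_cast; omega) =
          (extendIntXIso K' (m + 1)).hom ≫ G (m + 1) ≫ (extendIntXIso K (q + m + 1)).inv :=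
        extendCochain_v G (m + 1) (by push_cast; omega)
      rw [δ_v (q : ℤ) _ rfl _ _ _ hab ((q + m : ℕ) : ℤ) ((m + 1 : ℕ) : ℤ) (by push_cast; omega)
        (by push_cast; omega), h1, h2, extendInt_d, extendInt_d]
      simp [reassoc_of% hG, Int.negOnePow_succ]
      rw [← Int.coe_negOnePow_natCast]
      exact add_neg_cancel _)

variable {M M' T : A} (ε : (CochainComplex.single₀ A).obj M ⟶ K)
  (ε' : (CochainComplex.single₀ A).obj M' ⟶ K')

lemma augmentationInt_f_zero :
    (HomologicalComplex.singleObjXSelf (.up ℤ) 0 M).inv ≫ (augmentationInt ε).f 0 =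
      (CochainComplex.fromSingle₀Equiv K M ε).1 ≫ (extendIntXIso K 0).inv := by
  refine (congrArg _ (congrArg₂ (· ≫ ·) (HomologicalComplex.extendSingleIso_inv_f _ _ _ _ _)
    (HomologicalComplex.extendMap_f ε ComplexShape.embeddingUpNat (i := 0) rfl))).trans ?_
  simp only [extendIntXIso, CochainComplex.fromSingle₀Equiv_apply_coe, Category.assoc]
  refine (Iso.inv_hom_id_assoc _ _).trans ((Category.id_comp _).trans ?_)
  exact Iso.inv_hom_id_assoc _ _

/-- If `G 0` restricts to `g` along the augmentation of `K'`, then the morphism of complexes given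
by `G` extends the one given by `g`. -/
lemma precomp_augmentationInt_extendCocycle (G : ∀ m, K'.X m ⟶ K.X (q + m))
    (hG : ∀ m, G m ≫ K.d (q + m) (q + m + 1) = (-1 : ℤ) ^ q • K'.d m (m + 1) ≫ G (m + 1))
    (g : M' ⟶ K.X q) (hg : g ≫ K.d q (q + 1) = 0)
    (h : (CochainComplex.fromSingle₀Equiv K' M' ε').1 ≫ G 0 = g) :
    (extendCocycle G hG).precomp (augmentationInt ε') = homCocycle g hg := by
  ext : 1
  apply (Cochain.fromSingleEquiv (zero_add (q : ℤ))).injective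
  have h1 : (extendCochain G).v 0 (q : ℤ) (by simp) =
          (extendIntXIso K' 0).hom ≫ G 0 ≫ (extendIntXIso K q).inv :=
        extendCochain_v G 0 (by simp)
  have h2 := augmentationInt_f_zero ε'
  generalize (CochainComplex.fromSingle₀Equiv K' M' ε').1 = e at h h2
  have h3 : (extendCocycle G hG).1.v 0 (q : ℤ) (by simp) =
      (extendIntXIso K' 0).hom ≫ G 0 ≫ (extendIntXIso K q).inv := h1
  change _ ≫ (((Cochain.ofHom (augmentationInt ε')).comp (extendCocycle G hG).1
      (zero_add _)).v 0 (q : ℤ) _) =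
    _ ≫ (Cochain.fromSingleMk (g ≫ (extendIntXIso K q).inv) (zero_add _)).v 0 (q : ℤ) _
  rw [Cochain.zero_cochain_comp_v, Cochain.ofHom_v, Cochain.fromSingleMk_v, h3]
  refine (Category.assoc _ _ _).symm.trans ((congrArg (· ≫ _) h2).trans ?_)
  simp only [Category.assoc, Iso.inv_hom_id_assoc, reassoc_of% h]
  exact (Iso.inv_hom_id_assoc _ _).symm

lemma homCocycle_comp_extendCocycle (G : ∀ m, K'.X m ⟶ K.X (q + m))
    (hG : ∀ m, G m ≫ K.d (q + m) (q + m + 1) = (-1 : ℤ) ^ q • K'.d m (m + 1) ≫ G (m + 1))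
    {p : ℕ} (f : T ⟶ K'.X p) (hf : f ≫ K'.d p (p + 1) = 0)
    (hf' : (f ≫ G p) ≫ K.d (q + p) (q + p + 1) = 0) :
    (homCocycle (f ≫ G p) hf').1 =
      (homCocycle f hf).1.comp (extendCocycle G hG).1 (by push_cast; omega) := by
  apply (Cochain.fromSingleEquiv (zero_add ((q + p : ℕ) : ℤ))).injective
  have h1 := extendCochain_v G p (by push_cast; ring)
  change _ ≫ (Cochain.fromSingleMk ((f ≫ G p) ≫ (extendIntXIso K (q + p)).inv) (zero_add _)).v 0
    ((q + p : ℕ) : ℤ) _ = _ ≫ ((Cochain.fromSingleMk (f ≫ (extendIntXIso K' p).inv) (zero_add _)).comp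
      (extendCochain G) (by push_cast; omega)).v 0 ((q + p : ℕ) : ℤ) _
  rw [Cochain.fromSingleMk_v, Cochain.comp_v _ _ _ 0 (p : ℤ) ((q + p : ℕ) : ℤ) (zero_add _)
    (by push_cast; ring), Cochain.fromSingleMk_v, h1]
  refine (Iso.inv_hom_id_assoc _ _).trans (Eq.symm ?_)
  refine (Category.assoc _ _ _).symm.trans ((congrArg (· ≫ _) (Iso.inv_hom_id_assoc _ _)).trans ?_)
  simp

variable [HasExt.{w} A] [QuasiIso ε] [QuasiIso ε']

/-- Let `ε : M ⟶ K` and `ε' : M' ⟶ K'` be resolutions. If the cocycle `g : M' ⟶ K^q` extends to a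
morphism of complexes `G : K' ⟶ K[q]`, then composing in `Ext` with the class of `g` is composing
cocycles with `G`. -/
lemma extClass_comp_extClass (G : ∀ m, K'.X m ⟶ K.X (q + m))
    (hG : ∀ m, G m ≫ K.d (q + m) (q + m + 1) = (-1 : ℤ) ^ q • K'.d m (m + 1) ≫ G (m + 1))
    (g : M' ⟶ K.X q) (hg : g ≫ K.d q (q + 1) = 0)
    (h : (CochainComplex.fromSingle₀Equiv K' M' ε').1 ≫ G 0 = g)
    {p : ℕ} (f : T ⟶ K'.X p) (hf : f ≫ K'.d p (p + 1) = 0) :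
    (extClass.{w} ε' f hf).comp (extClass.{w} ε g hg) (Nat.add_comm p q) =
      extClass.{w} ε (f ≫ G p) (by
        rw [Category.assoc, hG, Preadditive.comp_zsmul, reassoc_of% hf, zero_comp, smul_zero]) := by
  let := HasDerivedCategory.standard A
  ext
  rw [Ext.comp_hom, extClass_hom, extClass_hom, extClass_hom,
    ← precomp_augmentationInt_extendCocycle ε' G hG g hg h, Cocycle.equivHomShift_symm_precomp,
    equivHomShift_symm_comp _ _ _ _ (homCocycle_comp_extendCocycle G hG f hf _)]
  -- `ε'` is invertible in the derived category: its inverse in the class of `f` cancels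
  -- against the `ε'` through which `g` factors.
  have h1 := shiftedHom_comp_of_comp_eq_id (D := DerivedCategory A)
    (show (q : ℤ) + (p : ℤ) = ((q + p : ℕ) : ℤ) by push_cast; rfl)
    ((DerivedCategory.singleFunctorIsoCompQ A 0).hom.app T)
    (ShiftedHom.map (Cocycle.equivHomShift.symm (homCocycle f hf)) DerivedCategory.Q)
    (inv (DerivedCategory.Q.map (augmentationInt ε')) ≫
      (DerivedCategory.singleFunctorIsoCompQ A 0).inv.app M')
    ((DerivedCategory.singleFunctorIsoCompQ A 0).hom.app M' ≫
      DerivedCategory.Q.map (augmentationInt ε'))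
    (ShiftedHom.map (Cocycle.equivHomShift.symm (extendCocycle G hG)) DerivedCategory.Q)
    (inv (DerivedCategory.Q.map (augmentationInt ε)) ≫
      (DerivedCategory.singleFunctorIsoCompQ A 0).inv.app M) (by simp)
  rw [← ShiftedHom.map_comp] at h1
  simp only [ShiftedHom.map, Category.assoc] at h1
  simp only [Functor.map_comp, Category.assoc] at h1 ⊢
  exact h1

end ShiftedCochainMap

/-! ### The cup product with a cochain as a morphism of sheaves -/

section CupHom

variable {X : TopCat.{u}} {k : Type u} [CommRing k]

/-- For a section `s` of `M` over `W ⊆ W'`, the morphism which sends a section `γ` of `k_X` over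
`V ∩ W'` to the section `γ s` of `M` over `V ∩ W`. -/
def mulInter (M : Mod X k) {W W' : Opens X} (h : W ≤ W') (s : M.val.obj (op W)) :
    interSheaf W' (constMod X k) ⟶ interSheaf W M :=
  toInter _ M W
    (fun V (γ : Sec X k (op (V ⊓ W'))) =>
      secRes (inf_le_inf_left V h) γ • res M (inf_le_right : V ⊓ W ≤ W) s)
    (fun V γ γ' => (congrArg (· • _) (map_add (secRes (inf_le_inf_left V h)) γ γ')).trans
      (add_smul _ _ _))
    (fun V r γ => by
      refine (congrArg (· • _) (map_mul (secRes (inf_le_inf_left V h))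
        (secRes (inf_le_left : V ⊓ W' ≤ V) r) γ)).trans ?_
      rw [mul_smul, secRes_secRes])
    (fun V V' h' γ => by
      rw [res_smul, res_res]
      exact congrArg (· • _)
        ((secRes_secRes (inf_le_inf_right W' h') (inf_le_inf_left V' h) γ).trans
          (secRes_secRes (inf_le_inf_left V h) (inf_le_inf_right W h') γ).symm))

variable {ι : Type u} {U : ι → Opens X} {M : Mod X k}

variable (U M) in
/-- The restriction to `W` of the component at `x` of a section over `V` of the Čech
resolution. -/
def compRes {n : ℕ} {V W : Opens X} (x : Fin (n + 1) → ι) (hV : W ≤ V) (hW : W ≤ inter U x)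
    (s : ((cechSheaf U M).X n).val.obj (op V)) : (kPresheaf M).obj (op W) :=
  resK M (le_inf hV hW) (comp U M x s)

lemma compRes_zsmul {n : ℕ} {V W : Opens X} (x : Fin (n + 1) → ι) (hV : W ≤ V)
    (hW : W ≤ inter U x) (c : ℤ) (s : ((cechSheaf U M).X n).val.obj (op V)) :
    compRes U M x hV hW (c • s) = c • compRes U M x hV hW s :=
  (congrArg (resK M (le_inf hV hW))
    (map_zsmul ((cechπ U (interFunctorSheaf M) x).val.app (op V)).hom c s)).trans
      (map_zsmul (resK M (le_inf hV hW)) c (comp U M x s))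

lemma compRes_d {n : ℕ} {V W : Opens X} (x : Fin (n + 2) → ι) (hV : W ≤ V) (hW : W ≤ inter U x)
    (s : ((cechSheaf U M).X n).val.obj (op V)) :
    compRes U M x hV hW (((cechSheaf U M).d n (n + 1)).val.app (op V) s) =
      ∑ j : Fin (n + 2), (-1 : ℤ) ^ (j : ℕ) •
        compRes U M (x ∘ j.succAbove) hV (hW.trans (inter_le_succAbove U x j)) s := by
  refine (congrArg (resK M (le_inf hV hW)) (comp_d U M x s)).trans ?_
  refine (res_sum M (le_inf hV hW) _ _ _).trans ?_
  refine Finset.sum_congr rfl fun j _ => congrArg _ ?_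
  exact res_res M _ _ _

variable (U) in
/-- The cup product with a Čech cochain `α` of `M`, as a morphism from the term of degree `m` of the
Čech resolution of `k_X` to the term of degree `q + m` of that of `M`. -/
def cupHom {q m n : ℕ} (h : q + m = n) (α : (cechComplex U M).X q) :
    (cechSheaf U (constMod X k)).X m ⟶ (cechSheaf U M).X n :=
  cechLift U (interFunctorSheaf M) fun x =>
    cechπ U (interFunctorSheaf (constMod X k)) (back h x) ≫
      mulInter M (inter_le_back U h x) (valueRes U M (front h x) (inter_le_front U h x) α)

lemma cupHom_π {q m n : ℕ} (h : q + m = n) (α : (cechComplex U M).X q) (x : Fin (n + 1) → ι) :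
    cupHom U h α ≫ cechπ U (interFunctorSheaf M) x =
      cechπ U (interFunctorSheaf (constMod X k)) (back h x) ≫
        mulInter M (inter_le_back U h x) (valueRes U M (front h x) (inter_le_front U h x) α) :=
  cechLift_π U _ _ x

lemma compRes_cupHom {q m n : ℕ} (h : q + m = n) (α : (cechComplex U M).X q) {V W : Opens X}
    (x : Fin (n + 1) → ι) (hV : W ≤ V) (hW : W ≤ inter U x)
    (γ : ((cechSheaf U (constMod X k)).X m).val.obj (op V)) :
    compRes U M x hV hW ((cupHom U h α).val.app (op V) γ) =
      sectionMul M (op W) (valueRes U M (front h x) (hW.trans (inter_le_front U h x)) α)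
        (compRes U (constMod X k) (back h x) hV (hW.trans (inter_le_back U h x)) γ) := by
  refine (congrArg (resK M (le_inf hV hW)) (congrArg (evalHom γ) (cupHom_π h α x))).trans ?_
  refine (res_smul M (le_inf hV hW) _ _).trans (congrArg₂ (· • ·) ?_ ?_)
  · exact secRes_secRes _ _ _
  · refine (res_res M _ _ _).trans ?_
    exact resK_valueRes (inter_le_front U h x) hW α

lemma sectionMul_compRes_congr {q m : ℕ} {V W : Opens X} {x x' : Fin (q + 1) → ι}
    {y y' : Fin (m + 1) → ι} (hx : x = x') (hy : y = y') (hV : W ≤ V) (h₁ : W ≤ inter U x)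
    (h₁' : W ≤ inter U x') (h₂ : W ≤ inter U y) (h₂' : W ≤ inter U y')
    (α : (cechComplex U M).X q) (γ : ((cechSheaf U (constMod X k)).X m).val.obj (op V)) :
    sectionMul M (op W) (valueRes U M x h₁ α) (compRes U (constMod X k) y hV h₂ γ) =
      sectionMul M (op W) (valueRes U M x' h₁' α) (compRes U (constMod X k) y' hV h₂' γ) := by
  subst hx hy; rfl

lemma compRes_ext {n : ℕ} {V : Opens X} {s s' : ((cechSheaf U M).X n).val.obj (op V)}
    (h : ∀ x, compRes U M x inf_le_left inf_le_right s =
      compRes U M x (inf_le_left : V ⊓ inter U x ≤ V) inf_le_right s') : s = s' :=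
  comp_ext U M fun x => (res_id M _).symm.trans ((h x).trans (res_id M _))

/-- The Leibniz rule for the cup product with a cocycle: it commutes with the differentials up to
the sign `(-1)^q`. -/
lemma cupHom_d {q m : ℕ} (α : (cechComplex U M).X q)
    (hα : (cechComplex U M).d q (q + 1) α = 0) :
    cupHom U (show q + m = q + m from rfl) α ≫ (cechSheaf U M).d (q + m) (q + m + 1) =
      (-1 : ℤ) ^ q • (cechSheaf U (constMod X k)).d m (m + 1) ≫
        cupHom U (show q + (m + 1) = q + m + 1 from rfl) α := by
  apply mod_hom_ext
  intro ⟨V⟩ γ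
  apply compRes_ext
  intro x
  trans (-1 : ℤ) ^ q • compRes U M x inf_le_left inf_le_right
    ((cupHom U (show q + (m + 1) = q + m + 1 from rfl) α).val.app (op V)
      (((cechSheaf U (constMod X k)).d m (m + 1)).val.app (op V) γ))
  swap
  · refine (compRes_zsmul x _ _ _ _).symm.trans ?_
    exact congrArg _ (map_zsmul (evalHom γ) ((-1 : ℤ) ^ q)
      ((cechSheaf U (constMod X k)).d m (m + 1) ≫
        cupHom U (show q + (m + 1) = q + m + 1 from rfl) α)).symm
  refine (compRes_d x _ _ ((cupHom U (show q + m = q + m from rfl) α).val.app (op V) γ)).trans ?_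
  rw [compRes_cupHom, compRes_d]
  simp only [compRes_cupHom]
  -- The value of `dα` at the first `q + 2` indices, multiplied by the component of `γ` at the
  -- remaining ones, is zero.
  have h0 := congrArg (fun s => sectionMul M (op (V ⊓ inter U x)) s
    (compRes U (constMod X k) (fun j => x ⟨q + 1 + j, by omega⟩) inf_le_left
      (inf_le_right.trans (inter_le_comp x _)) γ))
    ((valueRes_d (fun j : Fin (q + 2) => x ⟨j, by omega⟩)
      (inf_le_right.trans (inter_le_comp x _)) α).symm.trans
      ((congrArg _ hα).trans (map_zero (valueRes U M (W := V ⊓ inter U x) _ _))))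
  simp only [map_sum, map_zsmul, LinearMap.sum_apply,
    LinearMap.smul_apply, map_zero, LinearMap.zero_apply] at h0 ⊢
  rw [Fin.sum_univ_castSucc (n := q + 1)] at h0
  rw [Fin.sum_univ_succ (n := m + 1),
    ← Fin.sum_congr' _ (show (q + 1) + (m + 1) = q + m + 2 by omega), Fin.sum_univ_add]
  -- `a` and `b` are the faces of `x` which omit an index `≤ q`, resp. `> q`; `c + d` is the expansion
  -- of `dα ∪ γ` and `e + f` that of `(-1)^q α ∪ dγ`. The terms `d` and `e`, in which the last index
  -- of `dα`, resp. the first index of `dγ`, is omitted, cancel.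
  have e : ∀ a b c d e f : (kPresheaf M).obj (op (V ⊓ inter U x)), c + d = 0 → a = c → b = f →
      d + e = 0 → a + b = e + f := by
    rintro a b _ d e _ h' rfl rfl h
    rw [eq_neg_of_add_eq_zero_left h', eq_neg_of_add_eq_zero_right h]
  rw [smul_add]
  refine e _ _ _ _ _ _ h0 ?_ ?_ ?_
  · refine Finset.sum_congr rfl fun j _ => ?_
    refine congrArg₂ _ rfl (sectionMul_compRes_congr ?_ ?_ _ _ _ _ _ α γ)
    · funext a
      refine congrArg x (Fin.ext ?_)
      simp only [Fin.succAbove, Fin.lt_def, Fin.val_castSucc, Fin.val_cast, Fin.val_castAdd]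
      split_ifs <;> simp
    · funext a
      refine congrArg x (Fin.ext ?_)
      simp only [Fin.succAbove, Fin.lt_def, Fin.val_castSucc, Fin.val_cast, Fin.val_castAdd]
      split_ifs <;> simp <;> omega
  · rw [Finset.smul_sum]
    refine Finset.sum_congr rfl fun j _ => ?_
    rw [smul_smul, ← pow_add]
    refine congrArg₂ _ ?_ (sectionMul_compRes_congr ?_ ?_ _ _ _ _ _ α γ)
    · congr 1
      simp only [Fin.val_cast, Fin.val_natAdd, Fin.val_succ]
      omega
    · funext a
      refine congrArg x (Fin.ext ?_)
      simp only [Fin.succAbove, Fin.lt_def, Fin.val_castSucc, Fin.val_cast, Fin.val_natAdd]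
      split_ifs <;> simp <;> omega
    · funext a
      refine congrArg x (Fin.ext ?_)
      simp only [Fin.succAbove, Fin.lt_def, Fin.val_castSucc, Fin.val_cast, Fin.val_natAdd,
        Fin.val_succ]
      split_ifs <;> simp <;> omega
  · have h : q + (m + 1) = q + m + 1 := rfl
    have e₁ : (fun j : Fin (q + 2) => x ⟨j, by omega⟩) ∘ (Fin.last (q + 1)).succAbove =
        front h x := by
      funext a
      exact congrArg x (Fin.ext (by simp))
    have e₂ : (fun j : Fin (m + 1) => x ⟨q + 1 + j, by omega⟩) =
        back h x ∘ Fin.succAbove 0 := by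
      funext a
      exact congrArg x (Fin.ext (by simp; omega))
    rw [sectionMul_compRes_congr e₁ e₂ _ _ (inf_le_right.trans (inter_le_front U h x)) _
      (inf_le_right.trans ((inter_le_back U h x).trans (inter_le_succAbove U (back h x) 0))) α γ]
    simp [pow_succ]

/-- On sections coming from the augmentation, the cup product with `α` is multiplication of
sections of `k_X` with `α`. -/
lemma cechε₀_cupHom {q : ℕ} (α : (cechComplex U M).X q) :
    cechε₀ U (constMod X k) ≫ cupHom U (show q + 0 = q from rfl) α = cochainHom U M q α := by
  apply cech_hom_ext
  intro x
  rw [Category.assoc, cupHom_π, cochainHom_π]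
  apply mod_hom_ext
  intro ⟨V⟩ r
  refine congrArg₂ (fun (a : Sec X k (op (V ⊓ inter U x)))
    (b : M.val.obj (op (V ⊓ inter U x))) => a • b) ?_ ?_
  · refine (congrArg (secRes _) (comp_ε₀ U (constMod X k) _ r)).trans ?_
    exact secRes_secRes _ _ _
  · refine (res_res M _ _ _).trans ?_
    rfl

/-- On Čech cochains, seen as morphisms from `k_X` to the Čech resolution, `cupHom` is the cup
product. -/
lemma cochainHom_cupHom {q p n : ℕ} (h : q + p = n) (α : (cechComplex U M).X q)
    (β : (cechComplex U (constMod X k)).X p) :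
    cochainHom U (constMod X k) p β ≫ cupHom U h α =
      cochainHom U M n (cupCochain U M h α β) := by
  apply cech_hom_ext
  intro x
  rw [Category.assoc, cupHom_π, cochainHom_π, value_cupCochain]
  apply mod_hom_ext
  intro ⟨V⟩ r
  have h1 := congrArg (evalHom (V := op V) r) (cochainHom_π U (constMod X k) (back h x) β)
  refine (congrArg (fun s : Sec X k (op (V ⊓ inter U (back h x))) =>
    secRes (inf_le_inf_left V (inter_le_back U h x)) s • res M (inf_le_right : V ⊓ inter U x ≤ _)
      (show M.val.obj (op (inter U x)) from
        valueRes U M (front h x) (inter_le_front U h x) α)) h1).trans ?_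
  let a : M.val.obj (op (inter U x)) := valueRes U M (front h x) (inter_le_front U h x) α
  let b : Sec X k (op (inter U x)) :=
    valueRes U (constMod X k) (back h x) (inter_le_back U h x) β
  have h2 : secRes (inf_le_inf_left V (inter_le_back U h x))
      (smulRes (constMod X k) (value U (constMod X k) (back h x) β) V r) =
        secRes inf_le_left r * secRes inf_le_right b := by
    refine (map_mul (secRes _) _ _).trans (congrArg₂ (· * ·) (secRes_secRes _ _ _) ?_)
    exact (secRes_secRes _ _ _).trans (secRes_secRes _ _ _).symm
  refine (congrArg (· • res M inf_le_right a) h2).trans ((mul_smul _ _ _).trans ?_)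
  exact congrArg _ (res_smul M inf_le_right b a).symm

end CupHom

/-! ### Compatibility of the cup products -/

section Multiplicativity

open Abelian

variable {X : TopCat.{u}} {k : Type u} [CommRing k] {ι : Type u} {U : ι → Opens X}

/-- The composition in `Ext` of the classes of two Čech cocycles is the class of their cup product. -/
lemma extClass_cochainHom_comp [HasExt.{w} (Mod X k)] (hU : IsOpenCover U) (M : Mod X k)
    {q p n : ℕ} (h : q + p = n) (α : Cocycles (cechComplex U M) q)
    (β : Cocycles (cechComplex U (constMod X k)) p) :
    letI := cechε_quasiIso M hU
    letI := cechε_quasiIso (constMod X k) hU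
    (extClass.{w} (cechε U (constMod X k)) (cochainHom U (constMod X k) p β)
        (cocycleHom_d U _ β)).comp
      (extClass.{w} (cechε U M) (cochainHom U M q α) (cocycleHom_d U M α)) (by omega) =
    extClass.{w} (cechε U M) (cochainHom U M n (cupCochain U M h α β))
      (cocycleHom_d U M ⟨_, cupCochain_mem h α β⟩) := by
  have := cechε_quasiIso M hU
  have := cechε_quasiIso (constMod X k) hU
  subst h
  refine (extClass_comp_extClass (cechε U M) (cechε U (constMod X k))
    (fun m => cupHom U (show q + m = q + m from rfl) (α : (cechComplex U M).X q))
    (fun m => cupHom_d _ (cocycle_d α)) _ (cocycleHom_d U M α) ?_ _ (cocycleHom_d U _ β)).trans ?_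
  · rw [cechε, Equiv.apply_symm_apply]
    exact cechε₀_cupHom _
  · congr 1
    exact cochainHom_cupHom rfl _ _

end Multiplicativity

end CechCup

end

theorem mainTheorem4 {X : TopCat.{u}} {k : Type u} [CommRing k]
    [HasExt.{w} (CechCup.Mod X k)] {ι : Type u} (U : ι → Opens X) (hU : IsOpenCover U)
    (S : CechCup.Mod X k) (q p n : ℕ) (h : q + p = n) :
    CechCup.cechToSheaf.{w} S hU n ∘ₗ CechCup.cechCup U S h =
      CechCup.extCup.{w} S h ∘ₗ
        TensorProduct.map (CechCup.cechToSheaf.{w} S hU q)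
          (CechCup.cechToSheaf.{w} (CechCup.constMod X k) hU p) := by
  refine TensorProduct.ext' fun a b => ?_
  obtain ⟨α, rfl⟩ := CechCup.cohomologyClass_surjective _ _ a
  obtain ⟨β, rfl⟩ := CechCup.cohomologyClass_surjective _ _ b
  have h1 := CechCup.cechToSheaf_apply.{w} S hU n
    ⟨_, CechCup.cupCochain_mem h α β⟩
  rw [← CechCup.cechCupBilinear_apply h α β] at h1
  refine h1.trans ((CechCup.extClass_cochainHom_comp.{w} hU S h α β).symm.trans ?_)
  rw [← CechCup.cechToSheaf_apply.{w} S hU q α, ← CechCup.cechToSheaf_apply.{w} _ hU p β]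
  rfl
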